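/- Let $X$ be a real random variable with $\mathbb{E}\,\rho^X<\infty$ for every real $\rho>0$. For $z\in\mathbb{C}\setminus\{0\}$ put $f_X(z)=\mathbb{E}\,z^X$, where $z^r:=\exp(r\log z)$ with the principal branch of the logarithm, and put $u_X(z)=\log|f_X(z)|$. Let $\mu=\mathbb{E}X$, let $\sigma$ be the standard deviation of $X$, suppose $\sigma>0$, and let $X^*=(X-\mu)/\sigma$. Let $0<\delta\le\pi$ and $\kappa>0$, and let $S(\delta)=\{z\in\mathbb{C}\setminus\{0\}:|\arg z|<\delta\}$ (principal argument). Suppose that $f_X$ has no zeros in $S(\delta)$ and that $u_X$ satisfies the $(\kappa,\delta)$-growth condition $$\lim_{|z|\to\infty,\ z\in S(\delta)}\frac{|u_X(z)|}{|z|^{\kappa}}=0\qquad\text{and}\qquad \lim_{|z|\to\infty,\ z\in S(\delta)}\frac{|u_X(1/z)|}{|z|^{\kappa}}=0 .$$ Then, for $Z\sim N(0,1)$, $$\sup_{t\in\mathbb{R}}\bigl|\mathbb{P}(X^*\le t)-\mathbb{P}(Z\le t)\bigr|\;\le\;2^{3258}\cdot\frac{\max\{\delta^{-1},\kappa\}}{\sigma}.$$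 In particular the left-hand side is $O\bigl(\max\{\delta^{-1},\kappa\}/\sigma\bigr)$ with an absolute implied constant. -/

import Mathlib

open MeasureTheory ProbabilityTheory Filter Topology

/-- The (open) sector `{z ≠ 0 : |arg z| < δ}`. -/
def sector (δ : ℝ) : Set ℂ := {z : ℂ | z ≠ 0 ∧ |Complex.arg z| < δ}

/-- The probability generating function `f_X(z) = 𝔼 z^X` of a real random variable `X`, where
`z^r = exp (r log z)` with the principal branch of the logarithm. -/
noncomputable def probGenFun {Ω : Type*} [MeasurableSpace Ω] (X : Ω → ℝ) (P : Measure Ω)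
    (z : ℂ) : ℂ :=
  ∫ ω, Complex.exp ((X ω : ℂ) * Complex.log z) ∂P

/-- The logarithmic potential `u_X(z) = log |f_X(z)|`. -/
noncomputable def logPotential {Ω : Type*} [MeasurableSpace Ω] (X : Ω → ℝ) (P : Measure Ω)
    (z : ℂ) : ℝ :=
  Real.log ‖probGenFun X P z‖

/-- The `(κ, δ)`-growth condition: `|u(z)| / |z|^κ → 0` and `|u(1/z)| / |z|^κ → 0` as `|z| → ∞`
with `z` in the sector `|arg z| < δ`. -/
def GrowthCondition (κ δ : ℝ) (u : ℂ → ℝ) : Prop :=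
  Tendsto (fun z : ℂ => |u z| / ‖z‖ ^ κ) (Bornology.cobounded ℂ ⊓ 𝓟 (sector δ)) (𝓝 0) ∧
  Tendsto (fun z : ℂ => |u (1 / z)| / ‖z‖ ^ κ) (Bornology.cobounded ℂ ⊓ 𝓟 (sector δ)) (𝓝 0)

/-- The standard deviation of a real random variable. -/
noncomputable def stdDev {Ω : Type*} [MeasurableSpace Ω] (X : Ω → ℝ) (P : Measure Ω) : ℝ :=
  Real.sqrt (variance X P)

/-- The standardization `X* = (X - 𝔼 X) / σ`. -/
noncomputable def standardize {Ω : Type*} [MeasurableSpace Ω] (X : Ω → ℝ) (P : Measure Ω)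
    (ω : Ω) : ℝ :=
  (X ω - ∫ ω', X ω' ∂P) / stdDev X P

/-! The moment generating function `M w = 𝔼 exp (w X)` satisfies `f_X (exp w) = M w`, so it has no
zeros in the strip `|im w| < δ`, and `|M w| ≤ M (re w)` there. For small `η > 0` the quotient
`M w / M (w - 2 η i)` has modulus at most `1` on the lines `im w = η`, where the two arguments are
conjugate, and `im w = 2 η`, where `w - 2 η i` is real. The growth condition makes the
Phragmén–Lindelöf principle applicable in between, so `|M w| ≤ |M (w - 2 η i)|`. Differentiating at
`im w = η` shows that `M' / M` has nonnegative imaginary part in the upper half of a disc of radius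
`h` comparable to `1 / max δ⁻¹ κ`: it is typically real there.

Rogosinski's bound `|aₙ| hⁿ ≤ n |a₁| h` for the Taylor coefficients of typically real functions
follows from `|sin (n θ)| ≤ n |sin θ|` by integrating the imaginary part against `sin (n θ)`. For
`M' / M` the coefficient `a₁` is the variance, so `log M w = μ w + σ² w² / 2 + O (σ² |w|³ / h)` for
`|w| ≤ h / 2`. On the imaginary axis this says that the characteristic function of `X*` at `t` is
`exp (-t² / 2 + O (|t|³ / (σ h)))` for `|t| ≤ σ h / 2`, and Esseen's smoothing inequality turns it
into a bound of order `1 / (σ h)` for the distance to the normal distribution. -/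

open Metric Set
open scoped ComplexConjugate Real

/-! ### Typically real functions -/

section FourierCoefficients

open Complex (I)
open scoped Nat

theorem circleMap_sub_center_pow (c : ℂ) (r θ : ℝ) (n : ℕ) :
    (circleMap c r θ - c) ^ n = r ^ n * Complex.exp (n * θ * I) := by
  rw [circleMap, add_sub_cancel_left, mul_pow, ← Complex.exp_nat_mul, mul_assoc]

variable {f : ℂ → ℂ} {c : ℂ} {r : ℝ}

theorem continuous_comp_circleMap (hr : 0 < r) (hf : DiffContOnCl ℂ f (ball c r)) :
    Continuous fun θ => f (circleMap c r θ) :=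
  hf.continuousOn_ball.comp_continuous (continuous_circleMap c r)
    fun θ => circleMap_mem_closedBall c hr.le θ

theorem integral_circleMap_mul_exp_neg (hr : 0 < r) (hf : DiffContOnCl ℂ f (ball c r)) (n : ℕ) :
    ∫ θ in 0..2 * π, f (circleMap c r θ) * Complex.exp (-(n * θ * I))
      = 2 * π * (iteratedDeriv n f c / n !) * r ^ n := by
  have hr' : (r : ℂ) ≠ 0 := by exact_mod_cast hr.ne'
  have integrand_eq (θ : ℝ) : deriv (circleMap c r) θ •
      (1 / (circleMap c r θ - c) ^ (n + 1)) • f (circleMap c r θ)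
      = I / r ^ n * (f (circleMap c r θ) * Complex.exp (-(n * θ * I))) := by
    have hz : circleMap c r θ - c ≠ 0 := sub_ne_zero.mpr (circleMap_ne_center hr.ne')
    have hderiv : deriv (circleMap c r) θ = (circleMap c r θ - c) * I := by
      rw [deriv_circleMap, circleMap, circleMap, zero_add, add_sub_cancel_left]
    have hexp : Complex.exp (-(n * θ * I)) = r ^ n / (circleMap c r θ - c) ^ n := by
      rw [circleMap_sub_center_pow, Complex.exp_neg]
      field_simp
    rw [hderiv, hexp, smul_eq_mul, smul_eq_mul]
    field_simp
    ring
  have cauchy := hf.circleIntegral_one_div_sub_center_pow_smul hr n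
  simp_rw [circleIntegral, integrand_eq, intervalIntegral.integral_const_mul] at cauchy
  apply mul_left_cancel₀ (div_ne_zero Complex.I_ne_zero (pow_ne_zero n hr'))
  rw [cauchy, smul_eq_mul]
  field_simp

theorem integral_circleMap_mul_exp (hr : 0 < r) (hf : DiffContOnCl ℂ f (ball c r)) {n : ℕ}
    (hn : n ≠ 0) :
    ∫ θ in 0..2 * π, f (circleMap c r θ) * Complex.exp (n * θ * I) = 0 := by
  obtain ⟨m, rfl⟩ := Nat.exists_eq_succ_of_ne_zero hn
  have hr' : (r : ℂ) ≠ 0 := by exact_mod_cast hr.ne'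
  have integrand_eq (θ : ℝ) : deriv (circleMap c r) θ •
      ((circleMap c r θ - c) ^ m • f (circleMap c r θ))
      = I * r ^ (m + 1) * (f (circleMap c r θ) * Complex.exp ((m + 1 : ℕ) * θ * I)) := by
    have hderiv : deriv (circleMap c r) θ = (circleMap c r θ - c) * I := by
      rw [deriv_circleMap, circleMap, circleMap, zero_add, add_sub_cancel_left]
    rw [hderiv, smul_eq_mul, smul_eq_mul]
    linear_combination I * f (circleMap c r θ) * circleMap_sub_center_pow c r θ (m + 1)
  have hpow : DiffContOnCl ℂ (fun z => (z - c) ^ m) (ball c r) :=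
    Differentiable.diffContOnCl (by fun_prop)
  have cauchy := (hpow.smul hf).circleIntegral_eq_zero hr.le
  simp_rw [circleIntegral, integrand_eq, intervalIntegral.integral_const_mul] at cauchy
  exact (mul_eq_zero.mp cauchy).resolve_left (mul_ne_zero Complex.I_ne_zero (pow_ne_zero _ hr'))

theorem integral_circleMap_mul_sin (hr : 0 < r) (hf : DiffContOnCl ℂ f (ball c r)) {n : ℕ}
    (hn : n ≠ 0) :
    ∫ θ in 0..2 * π, f (circleMap c r θ) * Real.sin (n * θ)
      = π * I * (iteratedDeriv n f c / n !) * r ^ n := by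
  have hcont := continuous_comp_circleMap hr hf
  have euler (θ : ℝ) : f (circleMap c r θ) * Real.sin (n * θ)
      = I / 2 * (f (circleMap c r θ) * Complex.exp (-(n * θ * I))
        - f (circleMap c r θ) * Complex.exp (n * θ * I)) := by
    rw [Complex.ofReal_sin, Complex.sin]
    push_cast
    ring_nf
  simp_rw [euler, intervalIntegral.integral_const_mul]
  rw [intervalIntegral.integral_sub, integral_circleMap_mul_exp_neg hr hf,
    integral_circleMap_mul_exp hr hf hn]
  · ring
  all_goals exact (hcont.mul (by fun_prop)).intervalIntegrable _ _

theorem integral_im_circleMap_mul_sin (hr : 0 < r) (hf : DiffContOnCl ℂ f (ball c r)) {n : ℕ}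
    (hn : n ≠ 0) :
    ∫ θ in 0..2 * π, (f (circleMap c r θ)).im * Real.sin (n * θ)
      = π * (iteratedDeriv n f c / n !).re * r ^ n := by
  have hint : IntervalIntegrable (fun θ => f (circleMap c r θ) * Real.sin (n * θ))
      volume 0 (2 * π) :=
    ((continuous_comp_circleMap hr hf).mul (by fun_prop)).intervalIntegrable _ _
  have him := Complex.imCLM.intervalIntegral_comp_comm hint
  simp only [Complex.imCLM_apply, Complex.im_mul_ofReal] at him
  have coeff_eq : π * I * (iteratedDeriv n f c / n !) * r ^ n
      = ((π * r ^ n : ℝ) : ℂ) * (I * (iteratedDeriv n f c / n !)) := by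
    push_cast
    ring
  rw [him, integral_circleMap_mul_sin hr hf hn, coeff_eq, Complex.im_ofReal_mul, Complex.I_mul_im]
  ring

end FourierCoefficients

theorem iteratedDeriv_conj_conj (f : ℂ → ℂ) (n : ℕ) :
    iteratedDeriv n (conj ∘ f ∘ conj) = conj ∘ iteratedDeriv n f ∘ conj := by
  induction n with
  | zero => simp only [iteratedDeriv_zero]
  | succ n ih => rw [iteratedDeriv_succ, ih, deriv_conj_conj, ← iteratedDeriv_succ]

theorem abs_sin_nat_mul_le (n : ℕ) (x : ℝ) : |Real.sin (n * x)| ≤ n * |Real.sin x| := by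
  induction n with
  | zero => simp
  | succ n ih =>
    calc |Real.sin ((n + 1 : ℕ) * x)|
        = |Real.sin (n * x) * Real.cos x + Real.cos (n * x) * Real.sin x| := by
          rw [← Real.sin_add]
          push_cast
          ring_nf
      _ ≤ |Real.sin (n * x)| * |Real.cos x| + |Real.cos (n * x)| * |Real.sin x| := by
          rw [← abs_mul, ← abs_mul]
          exact abs_add_le _ _
      _ ≤ |Real.sin (n * x)| * 1 + 1 * |Real.sin x| := by
          gcongr <;> exact Real.abs_cos_le_one _
      _ ≤ (n + 1 : ℕ) * |Real.sin x| := by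
          push_cast
          linarith

/-- A function is typically real on a set `s` of complex numbers if it is holomorphic on `s`,
commutes with complex conjugation there, and maps the part of `s` in the closed upper half-plane
into the closed upper half-plane. The set `s` is meant to be invariant under conjugation. -/
structure TypicallyRealOn (f : ℂ → ℂ) (s : Set ℂ) : Prop where
  differentiableOn : DifferentiableOn ℂ f s
  map_conj : ∀ z ∈ s, f (conj z) = conj (f z)
  im_nonneg : ∀ z ∈ s, 0 ≤ z.im → 0 ≤ (f z).im

namespace TypicallyRealOn

open scoped Nat

variable {f : ℂ → ℂ} {R : ℝ}

theorem im_mul_im_nonneg (hf : TypicallyRealOn f (ball 0 R)) {z : ℂ} (hz : z ∈ ball 0 R) :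
    0 ≤ (f z).im * z.im := by
  rcases le_total 0 z.im with h | h
  · exact mul_nonneg (hf.im_nonneg z hz h) h
  · have hz' : conj z ∈ ball 0 R := by simpa using hz
    have him := hf.im_nonneg _ hz' (by simpa using h)
    rw [hf.map_conj z hz, Complex.conj_im] at him
    exact mul_nonneg_of_nonpos_of_nonpos (by linarith) h

theorem norm_iteratedDeriv_div_factorial (hf : TypicallyRealOn f (ball 0 R)) (hR : 0 < R) (n : ℕ) :
    ‖iteratedDeriv n f 0 / (n ! : ℂ)‖ = |(iteratedDeriv n f 0 / (n ! : ℂ)).re| := by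
  have hev : f =ᶠ[𝓝 0] conj ∘ f ∘ conj := by
    filter_upwards [ball_mem_nhds 0 hR] with z hz
    simp only [Function.comp_apply, hf.map_conj z hz, Complex.conj_conj]
  have hreal : conj (iteratedDeriv n f 0) = iteratedDeriv n f 0 := by
    conv_rhs => rw [hev.iteratedDeriv_eq n, iteratedDeriv_conj_conj]
    simp only [Function.comp_apply, map_zero]
  rw [← Complex.conj_eq_iff_re.mp hreal, ← Complex.ofReal_natCast, ← Complex.ofReal_div,
    Complex.norm_real, Complex.ofReal_re, Real.norm_eq_abs]

theorem norm_iteratedDeriv_div_factorial_mul_pow (hf : TypicallyRealOn f (ball 0 R)) {r : ℝ}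
    (hr : 0 < r) (hrR : r < R) {n : ℕ} (hn : n ≠ 0) :
    π * (‖iteratedDeriv n f 0 / (n ! : ℂ)‖ * r ^ n)
      = |∫ θ in 0..2 * π, (f (circleMap 0 r θ)).im * Real.sin (n * θ)| := by
  have hdiff : DiffContOnCl ℂ f (ball 0 r) :=
    hf.differentiableOn.diffContOnCl_ball (closedBall_subset_ball hrR)
  rw [integral_im_circleMap_mul_sin hr hdiff hn, abs_mul, abs_mul, abs_pow, abs_of_pos hr,
    abs_of_pos Real.pi_pos, hf.norm_iteratedDeriv_div_factorial (hr.trans hrR), mul_assoc]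

theorem abs_im_circleMap_mul_sin_le (hf : TypicallyRealOn f (ball 0 R)) {r : ℝ} (hr : 0 < r)
    (hrR : r < R) (n : ℕ) (θ : ℝ) :
    |(f (circleMap 0 r θ)).im * Real.sin (n * θ)|
      ≤ n * ((f (circleMap 0 r θ)).im * Real.sin θ) := by
  have hmem : circleMap 0 r θ ∈ ball 0 R :=
    closedBall_subset_ball hrR (circleMap_mem_closedBall 0 hr.le θ)
  have hsign : 0 ≤ (f (circleMap 0 r θ)).im * Real.sin θ := by
    have h := hf.im_mul_im_nonneg hmem
    have him : (circleMap 0 r θ).im = r * Real.sin θ := by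
      rw [circleMap_zero, Complex.im_ofReal_mul, Complex.exp_ofReal_mul_I_im]
    rw [him, mul_left_comm] at h
    exact nonneg_of_mul_nonneg_right h hr
  calc |(f (circleMap 0 r θ)).im * Real.sin (n * θ)|
      ≤ |(f (circleMap 0 r θ)).im| * (n * |Real.sin θ|) := by
        rw [abs_mul]
        gcongr
        exact abs_sin_nat_mul_le n θ
    _ = n * ((f (circleMap 0 r θ)).im * Real.sin θ) := by
        rw [mul_left_comm, ← abs_mul, abs_of_nonneg hsign]

theorem rogosinski_of_lt (hf : TypicallyRealOn f (ball 0 R)) {r : ℝ} (hr : 0 < r) (hrR : r < R)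
    {n : ℕ} (hn : n ≠ 0) :
    ‖iteratedDeriv n f 0 / (n ! : ℂ)‖ * r ^ n ≤ n * (‖deriv f 0‖ * r) := by
  have hcont : Continuous fun θ => (f (circleMap 0 r θ)).im :=
    Complex.continuous_im.comp <| continuous_comp_circleMap hr <|
      hf.differentiableOn.diffContOnCl_ball (closedBall_subset_ball hrR)
  have first := hf.norm_iteratedDeriv_div_factorial_mul_pow hr hrR one_ne_zero
  simp only [iteratedDeriv_one, Nat.factorial_one, Nat.cast_one, div_one, pow_one, one_mul] at first
  apply le_of_mul_le_mul_left _ Real.pi_pos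
  calc π * (‖iteratedDeriv n f 0 / (n ! : ℂ)‖ * r ^ n)
      = |∫ θ in 0..2 * π, (f (circleMap 0 r θ)).im * Real.sin (n * θ)| :=
        hf.norm_iteratedDeriv_div_factorial_mul_pow hr hrR hn
    _ ≤ ∫ θ in 0..2 * π, |(f (circleMap 0 r θ)).im * Real.sin (n * θ)| :=
        intervalIntegral.abs_integral_le_integral_abs Real.two_pi_pos.le
    _ ≤ ∫ θ in 0..2 * π, n * ((f (circleMap 0 r θ)).im * Real.sin θ) :=
        intervalIntegral.integral_mono_on Real.two_pi_pos.le
          ((hcont.mul (by fun_prop)).abs.intervalIntegrable _ _)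
          (((hcont.mul Real.continuous_sin).const_mul _).intervalIntegrable _ _)
          fun θ _ => hf.abs_im_circleMap_mul_sin_le hr hrR n θ
    _ ≤ n * |∫ θ in 0..2 * π, (f (circleMap 0 r θ)).im * Real.sin θ| := by
        rw [intervalIntegral.integral_const_mul]
        gcongr
        exact le_abs_self _
    _ = π * (n * (‖deriv f 0‖ * r)) := by
        rw [← first]
        ring

theorem rogosinski (hf : TypicallyRealOn f (ball 0 R)) (hR : 0 < R) {n : ℕ} (hn : n ≠ 0) :
    ‖iteratedDeriv n f 0 / (n ! : ℂ)‖ * R ^ n ≤ n * (‖deriv f 0‖ * R) := by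
  have hev : ∀ᶠ r in 𝓝[<] R, ‖iteratedDeriv n f 0 / (n ! : ℂ)‖ * r ^ n ≤ n * (‖deriv f 0‖ * r) := by
    filter_upwards [Ioo_mem_nhdsLT hR] with r hr using hf.rogosinski_of_lt hr.1 hr.2 hn
  refine le_of_tendsto_of_tendsto (b := 𝓝[<] R) ?_ ?_ hev <;>
    exact (Continuous.tendsto (by fun_prop) R).mono_left nhdsWithin_le_nhds

theorem norm_taylor_term_le (hf : TypicallyRealOn f (ball 0 R)) (hR : 0 < R) {w : ℂ}
    (hw : ‖w‖ ≤ R / 2) (n : ℕ) :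
    ‖iteratedDeriv (n + 2) f 0 / (n + 2)! * w ^ (n + 2)‖
      ≤ ‖deriv f 0‖ * ‖w‖ ^ 2 / R * (n * (1 / 2) ^ n + 2 * (1 / 2) ^ n) := by
  have hq : ‖w‖ / R ≤ 1 / 2 := by
    rw [div_le_iff₀ hR]
    linarith
  calc ‖iteratedDeriv (n + 2) f 0 / (n + 2)! * w ^ (n + 2)‖
      = ‖iteratedDeriv (n + 2) f 0 / (n + 2)!‖ * R ^ (n + 2) * (‖w‖ / R) ^ (n + 2) := by
        rw [norm_mul, norm_pow, div_pow]
        field_simp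
    _ ≤ (n + 2 : ℕ) * (‖deriv f 0‖ * R) * (‖w‖ / R) ^ (n + 2) := by
        gcongr ?_ * _
        exact hf.rogosinski hR (by lia)
    _ = ‖deriv f 0‖ * ‖w‖ ^ 2 / R * ((n + 2) * (‖w‖ / R) ^ n) := by
        rw [pow_add, div_pow _ _ 2]
        push_cast
        field_simp
    _ ≤ ‖deriv f 0‖ * ‖w‖ ^ 2 / R * ((n + 2) * (1 / 2) ^ n) := by gcongr
    _ = ‖deriv f 0‖ * ‖w‖ ^ 2 / R * (n * (1 / 2) ^ n + 2 * (1 / 2) ^ n) := by ring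

theorem norm_sub_sub_deriv_mul_le (hf : TypicallyRealOn f (ball 0 R)) (hR : 0 < R) {w : ℂ}
    (hw : ‖w‖ ≤ R / 2) :
    ‖f w - f 0 - deriv f 0 * w‖ ≤ 6 * ‖deriv f 0‖ * ‖w‖ ^ 2 / R := by
  have hmem : w ∈ ball 0 R := by
    rw [mem_ball_zero_iff]
    linarith
  have taylor : HasSum (fun n => iteratedDeriv (n + 2) f 0 / (n + 2)! * w ^ (n + 2))
      (f w - f 0 - deriv f 0 * w) := by
    have h := (hasSum_nat_add_iff' 2).mpr
      (Complex.hasSum_taylorSeries_on_ball hf.differentiableOn hmem)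
    simp only [sub_zero, smul_eq_mul, Finset.sum_range_succ, Finset.sum_range_zero,
      Nat.factorial_zero, Nat.factorial_one, Nat.cast_one, inv_one, pow_zero, pow_one, one_mul,
      iteratedDeriv_zero, iteratedDeriv_one, zero_add] at h
    convert! h using 1
    · ext n
      ring
    · ring
  have majorant : HasSum
      (fun n : ℕ => ‖deriv f 0‖ * ‖w‖ ^ 2 / R * (n * (1 / 2 : ℝ) ^ n + 2 * (1 / 2) ^ n))
      (6 * ‖deriv f 0‖ * ‖w‖ ^ 2 / R) := by
    have h := ((hasSum_coe_mul_geometric_of_norm_lt_one (𝕜 := ℝ) (r := 1 / 2) (by norm_num)).add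
      (hasSum_geometric_two.mul_left 2)).mul_left (‖deriv f 0‖ * ‖w‖ ^ 2 / R)
    convert! h using 1
    ring
  rw [← taylor.tsum_eq]
  exact tsum_of_norm_bounded majorant fun n => hf.norm_taylor_term_le hR hw n

end TypicallyRealOn

/-! ### Zero-free ridge functions -/

/-- The open horizontal strip of half-width `δ` around the real axis. -/
def strip (δ : ℝ) : Set ℂ := {w : ℂ | |w.im| < δ}

theorem mem_strip {δ : ℝ} {w : ℂ} : w ∈ strip δ ↔ |w.im| < δ := Iff.rfl

theorem isOpen_strip (δ : ℝ) : IsOpen (strip δ) :=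
  isOpen_lt Complex.continuous_im.abs continuous_const

theorem abs_im_lt_of_mem_ball_zero {w : ℂ} {h : ℝ} (hw : w ∈ ball 0 h) : |w.im| < h :=
  (Complex.abs_im_le_norm w).trans_lt (mem_ball_zero_iff.mp hw)

theorem ball_zero_subset_strip {h δ : ℝ} (hδ : 2 * h ≤ δ) : ball 0 h ⊆ strip δ := fun w hw => by
  have him := abs_im_lt_of_mem_ball_zero hw
  exact him.trans_le (by linarith [(abs_nonneg w.im).trans_lt him])

/-- A ridge function on the strip of half-width `δ`: a holomorphic function, real on the real axis,
whose modulus on each vertical line is largest on the real axis. It is moreover assumed to be free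
of zeros and to satisfy `|log ‖M w‖| = O(exp (κ * |re w|))`, the growth hypothesis under which
the Phragmén–Lindelöf principle applies on substrips of width less than `π / κ`. -/
structure ZeroFreeRidge (M : ℂ → ℂ) (δ κ : ℝ) : Prop where
  differentiableOn : DifferentiableOn ℂ M (strip δ)
  map_conj : ∀ w ∈ strip δ, M (conj w) = conj (M w)
  norm_le_norm_re : ∀ w ∈ strip δ, ‖M w‖ ≤ ‖M w.re‖
  ne_zero : ∀ w ∈ strip δ, M w ≠ 0
  log_norm_isBigO : (fun w => Real.log ‖M w‖)
    =O[comap (abs ∘ Complex.re) atTop ⊓ 𝓟 (strip δ)] fun w => Real.exp (κ * |w.re|)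

theorem isBigO_exp_mul_of_log_norm_isBigO {α : Type*} {l : Filter α} {f : α → ℂ} {g : α → ℝ}
    (hfg : (fun a => Real.log ‖f a‖) =O[l] g) (hg : ∀ a, 0 ≤ g a) :
    ∃ B, f =O[l] fun a => Real.exp (B * g a) := by
  obtain ⟨B, hB⟩ := hfg.bound
  refine ⟨B, .of_bound 1 ?_⟩
  filter_upwards [hB] with a ha
  rw [Real.norm_of_nonneg (hg a)] at ha
  rw [one_mul, Real.norm_eq_abs, Real.abs_exp]
  exact (Real.le_exp_log _).trans (Real.exp_le_exp.mpr ((le_abs_self _).trans ha))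

theorem hasDerivAt_norm_sq_add_mul_I {f : ℂ → ℂ} {w : ℂ} (hf : DifferentiableAt ℂ f w)
    (hw : f w ≠ 0) :
    HasDerivAt (fun t : ℝ => ‖f (w + t * Complex.I)‖ ^ 2)
      (-(2 * ‖f w‖ ^ 2 * (logDeriv f w).im)) 0 := by
  have hline : HasDerivAt (fun t : ℝ => w + t * Complex.I) Complex.I 0 := by
    simpa using ((Complex.ofRealCLM.hasDerivAt (x := 0)).mul_const Complex.I).const_add w
  have hfw : HasDerivAt f (deriv f w) (w + (0 : ℝ) * Complex.I) := by
    simpa using hf.hasDerivAt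
  have hnorm := (hfw.comp (0 : ℝ) hline).norm_sq
  have hderiv : deriv f w = logDeriv f w * f w := by
    rw [logDeriv_apply, div_mul_cancel₀ _ hw]
  convert! hnorm using 1
  simp only [Function.comp_apply, Complex.ofReal_zero, zero_mul, add_zero, Complex.inner, hderiv]
  rw [Complex.sq_norm, Complex.normSq_apply]
  simp only [Complex.mul_re, Complex.mul_im, Complex.conj_re, Complex.conj_im, Complex.I_re,
    Complex.I_im]
  ring

theorem nonpos_of_hasDerivAt_of_le_comp_neg {g : ℝ → ℝ} {d : ℝ} (hg : HasDerivAt g d 0)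
    (hle : ∀ᶠ t in 𝓝[>] 0, g t ≤ g (-t)) : d ≤ 0 := by
  have hneg : HasDerivAt (fun t => g (-t)) (-d) 0 := by
    simpa [Function.comp_def] using
      HasDerivAt.comp (0 : ℝ) (h := Neg.neg) (by rwa [neg_zero]) (hasDerivAt_neg 0)
  have hslope := (hg.sub hneg).tendsto_slope_zero_right
  have hdouble : d - -d ≤ 0 := by
    refine le_of_tendsto hslope ?_
    filter_upwards [hle, self_mem_nhdsWithin] with t ht ht0
    simp only [Pi.sub_apply, zero_add, neg_zero, sub_self, sub_zero, smul_eq_mul]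
    exact mul_nonpos_of_nonneg_of_nonpos (inv_nonneg.mpr (le_of_lt ht0)) (by linarith)
  linarith

theorem eq_mul_exp_of_hasDerivAt_logDeriv {f G : ℂ → ℂ} {h : ℝ}
    (hf : DifferentiableOn ℂ f (ball 0 h)) (hf0 : ∀ z ∈ ball 0 h, f z ≠ 0)
    (hG : ∀ z ∈ ball 0 h, HasDerivAt G (logDeriv f z) z) (hG0 : G 0 = 0) {w : ℂ}
    (hw : w ∈ ball 0 h) : f w = f 0 * Complex.exp (G w) := by
  have hlog : EqOn (logDeriv f) (logDeriv (Complex.exp ∘ G)) (ball 0 h) := fun z hz => by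
    rw [logDeriv_comp Complex.differentiableAt_exp (hG z hz).differentiableAt,
      Complex.logDeriv_exp, (hG z hz).deriv, Pi.one_apply, one_mul]
  obtain ⟨c, -, hc⟩ := (logDeriv_eqOn_iff hf
    (Complex.differentiable_exp.comp_differentiableOn
      fun z hz => (hG z hz).differentiableAt.differentiableWithinAt)
    isOpen_ball (convex_ball 0 h).isPreconnected (fun z _ => Complex.exp_ne_zero _) hf0).mp hlog
  have hc0 := hc (mem_ball_self (pos_of_mem_ball hw))
  have hcw := hc hw
  simp only [Pi.smul_apply, Function.comp_apply, smul_eq_mul] at hc0 hcw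
  rw [hcw, hc0, hG0, Complex.exp_zero, mul_one]

theorem norm_sub_sub_le_of_hasDerivAt {G G' : ℂ → ℂ} {a b w : ℂ} {C : ℝ}
    (hG : ∀ z ∈ closedBall 0 ‖w‖, HasDerivAt G (G' z) z) (hG0 : G 0 = 0) (hC : 0 ≤ C)
    (hG' : ∀ z ∈ closedBall 0 ‖w‖, ‖G' z - a - b * z‖ ≤ C * ‖z‖ ^ 2) :
    ‖G w - a * w - b * w ^ 2 / 2‖ ≤ C * ‖w‖ ^ 3 := by
  have hderiv (z : ℂ) (hz : z ∈ closedBall 0 ‖w‖) :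
      HasDerivAt (fun z => G z - a * z - b * z ^ 2 / 2) (G' z - a - b * z) z := by
    have hlin := (hasDerivAt_id z).const_mul a
    have hquad := (((hasDerivAt_id z).pow 2).const_mul b).div_const 2
    convert! ((hG z hz).sub hlin).sub hquad using 1
    simp only [mul_one, Nat.cast_ofNat, id_eq, Nat.add_one_sub_one, pow_one, sub_right_inj]
    ring
  have hbound (z : ℂ) (hz : z ∈ closedBall 0 ‖w‖) : ‖G' z - a - b * z‖ ≤ C * ‖w‖ ^ 2 := by
    have hzw := mem_closedBall_zero_iff.mp hz
    exact (hG' z hz).trans (by gcongr)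
  have h := (convex_closedBall (0 : ℂ) ‖w‖).norm_image_sub_le_of_norm_hasDerivWithin_le
    (fun z hz => (hderiv z hz).hasDerivWithinAt) hbound (x := 0) (y := w) (by simp) (by simp)
  simp only [hG0, sub_zero, mul_zero, ne_eq, OfNat.ofNat_ne_zero, not_false_eq_true, zero_pow,
    zero_div] at h
  exact h.trans_eq (by ring)

namespace ZeroFreeRidge

variable {M : ℂ → ℂ} {δ κ η : ℝ}

theorem mem_strip_and_sub_mem_strip (hηδ : 2 * η < δ) {z : ℂ} (hz : z.im ∈ Icc η (2 * η)) :
    z ∈ strip δ ∧ z - 2 * η * Complex.I ∈ strip δ := by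
  have him : (z - 2 * η * Complex.I).im = z.im - 2 * η := by simp
  simp only [strip, Set.mem_ofPred_eq, him, abs_lt]
  refine ⟨⟨?_, ?_⟩, ?_, ?_⟩ <;> linarith [hz.1, hz.2]

theorem tendsto_sub_mul_I (η : ℝ) (hηδ : 2 * η < δ) :
    Tendsto (fun z : ℂ => z - 2 * η * Complex.I)
      (comap (abs ∘ Complex.re) atTop ⊓ 𝓟 (Complex.im ⁻¹' Ioo η (2 * η)))
      (comap (abs ∘ Complex.re) atTop ⊓ 𝓟 (strip δ)) := by
  refine tendsto_inf.mpr ⟨tendsto_inf_left (tendsto_comap_iff.mpr ?_), tendsto_inf_right ?_⟩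
  · refine tendsto_comap.congr fun z => ?_
    simp
  · exact tendsto_principal_principal.mpr fun z hz =>
      (mem_strip_and_sub_mem_strip hηδ (Ioo_subset_Icc_self hz)).2

theorem exists_isBigO_div_sub_mul_I (hM : ZeroFreeRidge M δ κ) (hηδ : 2 * η < δ) :
    ∃ B, (fun z => M z / M (z - 2 * η * Complex.I))
      =O[comap (abs ∘ Complex.re) atTop ⊓ 𝓟 (Complex.im ⁻¹' Ioo η (2 * η))]
        fun z => Real.exp (B * Real.exp (κ * |z.re|)) := by
  refine isBigO_exp_mul_of_log_norm_isBigO ?_ fun z => (Real.exp_pos _).le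
  have hstrip : 𝓟 (Complex.im ⁻¹' Ioo η (2 * η)) ≤ 𝓟 (strip δ) :=
    principal_mono.mpr fun z hz =>
      (mem_strip_and_sub_mem_strip hηδ (Ioo_subset_Icc_self hz)).1
  have hshift := hM.log_norm_isBigO.comp_tendsto (tendsto_sub_mul_I η hηδ)
  refine ((hM.log_norm_isBigO.mono (inf_le_inf_left _ hstrip)).sub
    (by simpa [Function.comp_def] using hshift)).congr' ?_ .rfl
  filter_upwards [mem_inf_of_right (mem_principal_self _)] with z hz
  obtain ⟨hz₁, hz₂⟩ := mem_strip_and_sub_mem_strip hηδ (Ioo_subset_Icc_self hz)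
  rw [norm_div, Real.log_div (norm_ne_zero_iff.mpr (hM.ne_zero _ hz₁))
    (norm_ne_zero_iff.mpr (hM.ne_zero _ hz₂))]

theorem norm_le_norm_sub_mul_I (hM : ZeroFreeRidge M δ κ) (hη : 0 < η) (hηδ : 2 * η < δ)
    (hκη : κ * η < π) {w : ℂ} (hw : w.im ∈ Icc η (2 * η)) :
    ‖M w‖ ≤ ‖M (w - 2 * η * Complex.I)‖ := by
  have hpos {z : ℂ} (hz : z.im ∈ Icc η (2 * η)) : 0 < ‖M (z - 2 * η * Complex.I)‖ :=
    norm_pos_iff.mpr (hM.ne_zero _ (mem_strip_and_sub_mem_strip hηδ hz).2)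
  have hdiff : DiffContOnCl ℂ (fun z => M z / M (z - 2 * η * Complex.I))
      (Complex.im ⁻¹' Ioo η (2 * η)) := by
    refine DifferentiableOn.diffContOnCl (DifferentiableOn.mono (t := Complex.im ⁻¹' Icc η (2 * η))
      (.div ?_ ?_ fun z hz => norm_pos_iff.mp (hpos hz))
      (closure_minimal (preimage_mono Ioo_subset_Icc_self)
        (isClosed_Icc.preimage Complex.continuous_im)))
    · exact hM.differentiableOn.mono fun z hz => (mem_strip_and_sub_mem_strip hηδ hz).1
    · exact hM.differentiableOn.comp (by fun_prop)
        fun z hz => (mem_strip_and_sub_mem_strip hηδ hz).2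
  suffices ‖M w / M (w - 2 * η * Complex.I)‖ ≤ 1 by
    rwa [norm_div, div_le_one (hpos hw)] at this
  refine PhragmenLindelof.horizontal_strip (f := fun z => M z / M (z - 2 * η * Complex.I)) hdiff
    ⟨κ, ?_, hM.exists_isBigO_div_sub_mul_I hηδ⟩ (fun z hz => ?_) (fun z hz => ?_) hw.1 hw.2
  · rw [lt_div_iff₀ (by linarith)]
    linarith
  · have hz' : z.im ∈ Icc η (2 * η) := ⟨hz.ge, by linarith⟩
    have hconj : z - 2 * η * Complex.I = conj z := by
      have h := Complex.sub_conj z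
      rw [hz] at h
      push_cast at h
      linear_combination h
    rw [norm_div, div_le_one (hpos hz'), hconj,
      hM.map_conj z (mem_strip_and_sub_mem_strip hηδ hz').1, RCLike.norm_conj]
  · have hz' : z.im ∈ Icc η (2 * η) := ⟨by linarith, hz.le⟩
    have hre : z - 2 * η * Complex.I = z.re := by
      apply Complex.ext <;> simp [hz]
    rw [norm_div, div_le_one (hpos hz'), hre]
    exact hM.norm_le_norm_re z (mem_strip_and_sub_mem_strip hηδ hz').1

theorem differentiableAt (hM : ZeroFreeRidge M δ κ) {w : ℂ} (hw : w ∈ strip δ) :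
    DifferentiableAt ℂ M w :=
  hM.differentiableOn.differentiableAt ((isOpen_strip δ).mem_nhds hw)

theorem im_logDeriv_nonneg (hM : ZeroFreeRidge M δ κ) {w : ℂ} (hw : 0 < w.im)
    (hwδ : 2 * w.im < δ) (hwκ : κ * w.im < π) :
    0 ≤ (logDeriv M w).im := by
  have hmem : w ∈ strip δ := by
    rw [strip, Set.mem_ofPred_eq, abs_of_pos hw]
    linarith
  have hMw : 0 < ‖M w‖ := norm_pos_iff.mpr (hM.ne_zero w hmem)
  have hle : ∀ᶠ t : ℝ in 𝓝[>] 0,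
      ‖M (w + t * Complex.I)‖ ^ 2 ≤ ‖M (w + (-t : ℝ) * Complex.I)‖ ^ 2 := by
    filter_upwards [Ioo_mem_nhdsGT hw] with t ht
    have him : (w + t * Complex.I).im ∈ Icc w.im (2 * w.im) := by
      simp only [Complex.add_im, Complex.im_ofReal_mul, Complex.I_im]
      constructor <;> linarith [ht.1, ht.2]
    have hconj : w + t * Complex.I - 2 * w.im * Complex.I
        = conj (w + (-t : ℝ) * Complex.I) := by
      have h := Complex.sub_conj w
      simp only [map_add, map_mul, Complex.conj_ofReal, Complex.conj_I]
      push_cast at h ⊢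
      linear_combination h
    have hmem' : w + (-t : ℝ) * Complex.I ∈ strip δ := by
      simp only [strip, Set.mem_ofPred_eq, Complex.add_im, Complex.im_ofReal_mul, Complex.I_im,
        abs_lt]
      constructor <;> linarith [ht.1, ht.2]
    have h := hM.norm_le_norm_sub_mul_I hw hwδ hwκ him
    rw [hconj, hM.map_conj _ hmem', RCLike.norm_conj] at h
    gcongr
  have h := nonpos_of_hasDerivAt_of_le_comp_neg
    (hasDerivAt_norm_sq_add_mul_I (hM.differentiableAt hmem) (hM.ne_zero w hmem)) hle
  exact nonneg_of_mul_nonneg_right (neg_nonpos.mp h) (by positivity)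

theorem logDeriv_conj (hM : ZeroFreeRidge M δ κ) {w : ℂ} (hw : w ∈ strip δ) :
    logDeriv M (conj w) = conj (logDeriv M w) := by
  have hev : M =ᶠ[𝓝 w] conj ∘ M ∘ conj := by
    filter_upwards [(isOpen_strip δ).mem_nhds hw] with z hz
    simp only [Function.comp_apply, hM.map_conj z hz, Complex.conj_conj]
  rw [logDeriv_apply, logDeriv_apply, hM.map_conj w hw, map_div₀]
  conv_rhs => rw [hev.deriv_eq, deriv_conj_conj]
  simp only [Function.comp_apply, Complex.conj_conj]

theorem typicallyRealOn_logDeriv (hM : ZeroFreeRidge M δ κ) {h : ℝ} (hδ : 2 * h ≤ δ)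
    (hκ : κ * h ≤ π) :
    TypicallyRealOn (logDeriv M) (ball 0 h) := by
  have hsub := ball_zero_subset_strip hδ
  refine ⟨?_, fun z hz => hM.logDeriv_conj (hsub hz), fun z hz hz0 => ?_⟩
  · exact ((hM.differentiableOn.deriv (isOpen_strip δ)).div hM.differentiableOn hM.ne_zero).mono
      hsub
  · have hzh := (le_abs_self _).trans_lt (abs_im_lt_of_mem_ball_zero hz)
    rcases hz0.eq_or_lt with hz0 | hz0
    · have hreal : conj z = z := Complex.conj_eq_iff_im.mpr hz0.symm
      have h := hM.logDeriv_conj (hsub hz)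
      rw [hreal] at h
      exact (Complex.conj_eq_iff_im.mp h.symm).ge
    · refine hM.im_logDeriv_nonneg hz0 (by linarith) ?_
      rcases le_or_gt κ 0 with hκ0 | hκ0
      · exact (mul_nonpos_of_nonpos_of_nonneg hκ0 hz0.le).trans_lt Real.pi_pos
      · exact (mul_lt_mul_of_pos_left hzh hκ0).trans_le hκ

theorem exists_eq_exp (hM : ZeroFreeRidge M δ κ) {h : ℝ} (hh : 0 < h) (hδ : 2 * h ≤ δ)
    (hκ : κ * h ≤ π) {w : ℂ} (hw : ‖w‖ ≤ h / 2) :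
    ∃ R : ℂ, M w = M 0 * Complex.exp
        (logDeriv M 0 * w + deriv (logDeriv M) 0 * w ^ 2 / 2 + R) ∧
      ‖R‖ ≤ 6 * ‖deriv (logDeriv M) 0‖ / h * ‖w‖ ^ 3 := by
  have hsub := ball_zero_subset_strip hδ
  have hreal := hM.typicallyRealOn_logDeriv hδ hκ
  obtain ⟨G, hG0, hG⟩ := hreal.differentiableOn.isExactOn_ball.with_val_at 0 0
  refine ⟨G w - logDeriv M 0 * w - deriv (logDeriv M) 0 * w ^ 2 / 2, ?_, ?_⟩
  · rw [eq_mul_exp_of_hasDerivAt_logDeriv (hM.differentiableOn.mono hsub)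
      (fun z hz => hM.ne_zero z (hsub hz)) hG hG0
      (mem_ball_zero_iff.mpr (by linarith))]
    ring_nf
  · refine norm_sub_sub_le_of_hasDerivAt
      (fun z hz => hG z (closedBall_subset_ball (by linarith) hz)) hG0 (by positivity)
      fun z hz => ?_
    rw [mem_closedBall_zero_iff] at hz
    exact (hreal.norm_sub_sub_deriv_mul_le hh (hz.trans hw)).trans_eq (by ring)

end ZeroFreeRidge

/-! ### Smoothing with the Fejér kernel -/

theorem mul_integral_le_integral_mul_add {α : Type*} [MeasurableSpace α] {μ : Measure α}
    {k H : α → ℝ} {s : Set α} {D m : ℝ} (hk : Integrable k μ) (hk0 : ∀ x, 0 ≤ k x)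
    (hH : AEStronglyMeasurable H μ) (hHD : ∀ x, |H x| ≤ D) (hs : MeasurableSet s)
    (hm : ∀ x ∈ s, m ≤ H x) (hmD : m ≤ D) :
    m * ∫ x, k x ∂μ ≤ ∫ x, k x * H x ∂μ + 2 * D * ∫ x in sᶜ, k x ∂μ := by
  have hkH : Integrable (fun x => k x * H x) μ := hk.mul_bdd hH (ae_of_all _ hHD)
  have htail : Integrable (sᶜ.indicator k) μ := hk.indicator hs.compl
  rw [← integral_indicator hs.compl, ← integral_const_mul, ← integral_const_mul,
    ← integral_add hkH (htail.const_mul _)]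
  refine integral_mono (hk.const_mul _) (hkH.add (htail.const_mul _)) fun x => ?_
  have hHx := abs_le.mp (hHD x)
  by_cases hx : x ∈ s
  · rw [indicator_of_notMem (notMem_compl_iff.mpr hx), mul_zero, add_zero, mul_comm]
    exact mul_le_mul_of_nonneg_left (hm x hx) (hk0 x)
  · rw [indicator_of_mem (mem_compl hx)]
    nlinarith [mul_nonneg (hk0 x) (by linarith : 0 ≤ H x + 2 * D - m)]

/-- The Fejér kernel on the real line, the Fourier transform of the triangle function
`t ↦ max (1 - |t|) 0`. It is not normalised: its integral is `2π`. -/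
noncomputable def fejerKernel (x : ℝ) : ℝ := Real.sinc (x / 2) ^ 2

@[fun_prop]
theorem continuous_fejerKernel : Continuous fejerKernel :=
  (Real.continuous_sinc.comp (by fun_prop)).pow 2

theorem fejerKernel_nonneg (x : ℝ) : 0 ≤ fejerKernel x := sq_nonneg _

theorem fejerKernel_neg (x : ℝ) : fejerKernel (-x) = fejerKernel x := by
  rw [fejerKernel, fejerKernel, neg_div, Real.sinc_neg]

theorem fejerKernel_abs (x : ℝ) : fejerKernel |x| = fejerKernel x := by
  rcases abs_choice x with h | h <;> rw [h]
  exact fejerKernel_neg x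

theorem fejerKernel_le_one (x : ℝ) : fejerKernel x ≤ 1 :=
  (sq_le_one_iff_abs_le_one _).mpr (Real.abs_sinc_le_one _)

theorem abs_fejerKernel_le_one (x : ℝ) : |fejerKernel x| ≤ 1 :=
  (abs_of_nonneg (fejerKernel_nonneg x)).trans_le (fejerKernel_le_one x)

theorem fejerKernel_mul_sq_le (x : ℝ) : fejerKernel x * x ^ 2 ≤ 4 := by
  rcases eq_or_ne x 0 with rfl | hx
  · norm_num
  · rw [fejerKernel, Real.sinc_of_ne_zero (by simpa using hx)]
    have := Real.sin_sq_le_one (x / 2)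
    field_simp
    linarith

theorem integrable_fejerKernel : Integrable fejerKernel := by
  refine (integrable_inv_one_add_sq.const_mul 5).mono'
    continuous_fejerKernel.aestronglyMeasurable (ae_of_all _ fun x => ?_)
  rw [Real.norm_eq_abs, abs_of_nonneg (fejerKernel_nonneg x), ← div_eq_mul_inv,
    le_div_iff₀ (by positivity)]
  linarith [fejerKernel_le_one x, fejerKernel_mul_sq_le x]

theorem half_le_fejerKernel {x : ℝ} (hx : |x| ≤ 1) : 1 / 2 ≤ fejerKernel x := by
  rw [← fejerKernel_abs]
  rcases (abs_nonneg x).eq_or_lt with h0 | h0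
  · norm_num [← h0, fejerKernel]
  · have hsinc : 3 / 4 ≤ Real.sinc (|x| / 2) := by
      have hsin := Real.sin_gt_sub_cube (x := |x| / 2) (by positivity)
      have hcube : (|x| / 2) ^ 3 ≤ |x| / 2 :=
        pow_le_of_le_one (by positivity) (by linarith) (by norm_num)
      rw [Real.sinc_of_ne_zero (by positivity), le_div_iff₀ (by positivity)]
      linarith
    rw [fejerKernel]
    nlinarith

theorem one_le_integral_fejerKernel : 1 ≤ ∫ x, fejerKernel x :=
  calc (1 : ℝ) = ∫ _ in Icc (-1 : ℝ) 1, (1 / 2 : ℝ) := by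
        rw [setIntegral_const]
        norm_num [Measure.real]
    _ ≤ ∫ x in Icc (-1 : ℝ) 1, fejerKernel x :=
        setIntegral_mono_on (integrableOn_const (by simp)) integrable_fejerKernel.integrableOn
          measurableSet_Icc fun x hx => half_le_fejerKernel (abs_le.mpr hx)
    _ ≤ ∫ x, fejerKernel x :=
        setIntegral_le_integral integrable_fejerKernel (ae_of_all _ fejerKernel_nonneg)

theorem setIntegral_fejerKernel_lt_abs_le {a : ℝ} (ha : 0 < a) :
    ∫ x in {x | a < |x|}, fejerKernel x ≤ 8 / a := by
  have hpow : IntegrableOn (fun x : ℝ => 4 * x ^ (-2 : ℝ)) (Ioi a) :=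
    (integrableOn_Ioi_rpow_of_lt (by norm_num) ha).const_mul 4
  have hle (x : ℝ) (hx : x ∈ Ioi a) : fejerKernel x ≤ 4 * x ^ (-2 : ℝ) := by
    have hx0 : 0 < x := ha.trans hx
    rw [Real.rpow_neg hx0.le, Real.rpow_two, ← div_eq_mul_inv, le_div_iff₀ (by positivity)]
    exact fejerKernel_mul_sq_le x
  have heven (x : ℝ) : {x : ℝ | a < |x|}.indicator fejerKernel x
      = (Ioi a).indicator fejerKernel |x| := by
    simp only [indicator_apply, Set.mem_ofPred_eq, mem_Ioi, fejerKernel_abs]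
  calc ∫ x in {x | a < |x|}, fejerKernel x
      = 2 * ∫ x in Ioi a, fejerKernel x := by
        rw [← integral_indicator (measurableSet_lt (by fun_prop) (by fun_prop))]
        simp_rw [heven]
        rw [integral_comp_abs, setIntegral_indicator measurableSet_Ioi, Ioi_inter_Ioi,
          max_eq_right ha.le]
    _ ≤ 2 * ∫ x in Ioi a, 4 * x ^ (-2 : ℝ) := by
        refine mul_le_mul_of_nonneg_left ?_ zero_le_two
        exact setIntegral_mono_on integrable_fejerKernel.integrableOn hpow measurableSet_Ioi hle
    _ = 8 / a := by
        rw [integral_const_mul, integral_Ioi_rpow_of_lt (by norm_num) ha]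
        norm_num [Real.rpow_neg_one]
        ring

theorem integral_triangle_mul_cos (x : ℝ) :
    ∫ t in (0 : ℝ)..1, 2 * (1 - t) * Real.cos (t * x) = fejerKernel x := by
  rcases eq_or_ne x 0 with rfl | hx
  · simp only [mul_zero, Real.cos_zero, mul_one, fejerKernel, zero_div, Real.sinc_zero, one_pow]
    rw [intervalIntegral.integral_const_mul, intervalIntegral.integral_sub (by simp) (by simp)]
    norm_num
  · have hderiv (t : ℝ) : HasDerivAt
        (fun t => 2 * (1 - t) * Real.sin (t * x) / x - 2 * Real.cos (t * x) / x ^ 2)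
        (2 * (1 - t) * Real.cos (t * x)) t := by
      have hmul : HasDerivAt (fun t : ℝ => t * x) x t := hasDerivAt_mul_const x
      have htri : HasDerivAt (fun t : ℝ => 2 * (1 - t)) (-2) t := by
        simpa using ((hasDerivAt_id t).const_sub 1).const_mul 2
      convert! ((htri.mul hmul.sin).div_const x).sub
        ((hmul.cos.const_mul 2).div_const (x ^ 2)) using 1
      field_simp
      ring
    have hcos : Real.cos x = 1 - 2 * Real.sin (x / 2) ^ 2 := by
      rw [Real.sin_sq_eq_half_sub, mul_div_cancel₀ x two_ne_zero]
      ring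
    rw [intervalIntegral.integral_eq_sub_of_hasDerivAt (fun t _ => hderiv t)
      (Continuous.intervalIntegrable (by fun_prop) _ _), fejerKernel,
      Real.sinc_of_ne_zero (by simpa using hx)]
    simp only [one_mul, zero_mul, Real.cos_zero, Real.sin_zero, hcos]
    field_simp
    ring

theorem integral_triangle_mul_exp (x : ℝ) :
    ∫ t in (-1 : ℝ)..1, ((1 - |t| : ℝ) : ℂ) * Complex.exp (t * x * Complex.I)
      = (fejerKernel x : ℂ) := by
  set f : ℝ → ℂ := fun t => ((1 - |t| : ℝ) : ℂ) * Complex.exp (t * x * Complex.I) with hf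
  have hcont : Continuous f := by fun_prop
  have hsum (t : ℝ) (ht : t ∈ uIcc 0 1) :
      f (-t) + f t = ((2 * (1 - t) * Real.cos (t * x) : ℝ) : ℂ) := by
    rw [uIcc_of_le zero_le_one] at ht
    simp only [hf, abs_neg, abs_of_nonneg ht.1]
    push_cast
    rw [Complex.cos, neg_mul, neg_mul]
    ring_nf
  have hneg := intervalIntegral.integral_comp_neg f (a := 0) (b := 1)
  rw [neg_zero] at hneg
  rw [← intervalIntegral.integral_add_adjacent_intervals (hcont.intervalIntegrable (-1) 0)
    (hcont.intervalIntegrable 0 1), ← hneg, ← intervalIntegral.integral_add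
    (Continuous.intervalIntegrable (by fun_prop) _ _) (hcont.intervalIntegrable _ _),
    intervalIntegral.integral_congr hsum, intervalIntegral.integral_ofReal,
    integral_triangle_mul_cos]

/-- The convolution of a function with the (unnormalised) Fejér kernel. -/
noncomputable def fejerMean (F : ℝ → ℝ) (c : ℝ) : ℝ := ∫ y, fejerKernel y * F (c - y)

theorem integrable_fejerKernel_mul_comp_sub {F : ℝ → ℝ} {D : ℝ} (hF : Measurable F)
    (hD : ∀ x, |F x| ≤ D) (c : ℝ) : Integrable fun y => fejerKernel y * F (c - y) :=
  integrable_fejerKernel.mul_bdd (hF.comp (measurable_const.sub measurable_id)).aestronglyMeasurable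
    (ae_of_all _ fun y => hD (c - y))

theorem fejerMean_neg (F : ℝ → ℝ) (c : ℝ) : fejerMean (-F) c = -fejerMean F c := by
  simp only [fejerMean, Pi.neg_apply, mul_neg, integral_neg]

-- The window `[-32, 32]` misses at most `8 / 32` of the mass of the kernel, so the loss is at most
-- half of the supremum `D` of `|F|` and can be absorbed on taking suprema.
theorem le_abs_fejerMean_add {F : ℝ → ℝ} {D m c : ℝ} (hF : Measurable F)
    (hD : ∀ x, |F x| ≤ D) (hm : ∀ y, |y| ≤ 32 → m ≤ F (c - y)) :
    m ≤ |fejerMean F c| + D / 2 := by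
  have hD0 : 0 ≤ D := (abs_nonneg _).trans (hD 0)
  rcases le_or_gt m 0 with hm0 | hm0
  · exact hm0.trans (by positivity)
  · have hmD : m ≤ D := (hm 0 (by norm_num)).trans ((le_abs_self _).trans (hD _))
    have hcompl : {y : ℝ | |y| ≤ 32}ᶜ = {y | 32 < |y|} := by
      ext y
      simp
    have htail : ∫ y in {y : ℝ | |y| ≤ 32}ᶜ, fejerKernel y ≤ 8 / 32 :=
      hcompl ▸ setIntegral_fejerKernel_lt_abs_le (by norm_num)
    calc m ≤ m * ∫ y, fejerKernel y := le_mul_of_one_le_right hm0.le one_le_integral_fejerKernel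
      _ ≤ fejerMean F c + 2 * D * ∫ y in {y : ℝ | |y| ≤ 32}ᶜ, fejerKernel y :=
          mul_integral_le_integral_mul_add integrable_fejerKernel fejerKernel_nonneg
            (hF.comp (measurable_const.sub measurable_id)).aestronglyMeasurable
            (fun y => hD (c - y)) (measurableSet_le (by fun_prop) (by fun_prop)) hm hmD
      _ ≤ |fejerMean F c| + 2 * D * (8 / 32) := by
          gcongr
          exact le_abs_self _
      _ = |fejerMean F c| + D / 2 := by ring

theorem abs_le_of_abs_fejerMean_le {F : ℝ → ℝ} {ε B : ℝ} (hF : Measurable F)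
    (hbdd : BddAbove (range fun x => |F x|)) (hε : 0 ≤ ε)
    (hdec : ∀ x y, x ≤ y → F x ≤ F y + ε * (y - x)) (hB : ∀ c, |fejerMean F c| ≤ B) (x : ℝ) :
    |F x| ≤ 128 * ε + 2 * B := by
  set D := ⨆ x, |F x|
  have hD (x : ℝ) : |F x| ≤ D := le_ciSup hbdd x
  have hhalf (x : ℝ) : |F x| ≤ 64 * ε + B + D / 2 := by
    refine abs_le'.mpr ⟨?_, ?_⟩
    · have hwindow (y : ℝ) (hy : |y| ≤ 32) : F x - 64 * ε ≤ F (x + 32 - y) := by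
        have hy' := abs_le.mp hy
        nlinarith [hdec x (x + 32 - y) (by linarith)]
      linarith [le_abs_fejerMean_add hF hD hwindow, hB (x + 32)]
    · have hwindow (y : ℝ) (hy : |y| ≤ 32) : -F x - 64 * ε ≤ -F (x - 32 - y) := by
        have hy' := abs_le.mp hy
        nlinarith [hdec (x - 32 - y) x (by linarith)]
      have hneg := le_abs_fejerMean_add hF.neg (fun z => (abs_neg (F z)).trans_le (hD z)) hwindow
      rw [fejerMean_neg, abs_neg] at hneg
      linarith [hB (x - 32)]
  linarith [hhalf x, ciSup_le hhalf]

theorem norm_integral_exp_neg_mul_I_le {t : ℝ} (ht : t ≠ 0) (a b : ℝ) :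
    ‖∫ c in a..b, Complex.exp (-(t * c) * Complex.I)‖ ≤ 2 / |t| := by
  have hrw (c : ℝ) : Complex.exp (-(t * c) * Complex.I) = Complex.exp (-t * Complex.I * c) := by
    ring_nf
  have hnorm (c : ℝ) : ‖Complex.exp (-t * Complex.I * c)‖ = 1 := by
    rw [mul_right_comm, ← Complex.ofReal_neg, ← Complex.ofReal_mul, Complex.norm_exp_ofReal_mul_I]
  simp_rw [hrw]
  rw [integral_exp_mul_complex (by simp [ht]), norm_div, norm_mul, Complex.norm_I, mul_one,
    norm_neg, Complex.norm_real, Real.norm_eq_abs]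
  gcongr
  exact (norm_sub_le _ _).trans_eq (by rw [hnorm, hnorm]; norm_num)

theorem norm_integral_triangle_mul_exp_mul_le {t : ℝ} (ht : |t| ≤ 1) {d : ℂ}
    (hd : t = 0 → d = 0) (a b : ℝ) :
    ‖∫ c in a..b, ((1 - |t| : ℝ) : ℂ) * Complex.exp (-(t * c) * Complex.I) * d‖
      ≤ 2 * (‖d‖ / |t|) := by
  rcases eq_or_ne t 0 with h0 | h0
  · simp [hd h0]
  · rw [intervalIntegral.integral_mul_const, intervalIntegral.integral_const_mul, norm_mul,
      norm_mul, Complex.norm_real, Real.norm_eq_abs, abs_of_nonneg (sub_nonneg.mpr ht)]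
    calc (1 - |t|) * ‖∫ c in a..b, Complex.exp (-(t * c) * Complex.I)‖ * ‖d‖
        ≤ 1 * (2 / |t|) * ‖d‖ := by
          gcongr
          · linarith [abs_nonneg t]
          · exact norm_integral_exp_neg_mul_I_le h0 a b
      _ = 2 * (‖d‖ / |t|) := by ring

section CharFun

variable (μ ν : Measure ℝ)

theorem measurable_cdf : Measurable (cdf μ) := (monotone_cdf μ).measurable

theorem abs_cdf_le_one (x : ℝ) : |cdf μ x| ≤ 1 :=
  (abs_of_nonneg (cdf_nonneg μ x)).trans_le (cdf_le_one μ x)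

theorem tendsto_fejerMean_cdf_atBot : Tendsto (fejerMean (cdf μ)) atBot (𝓝 0) := by
  rw [← integral_zero ℝ ℝ]
  refine tendsto_integral_filter_of_dominated_convergence fejerKernel
    (Eventually.of_forall fun c => (integrable_fejerKernel_mul_comp_sub (measurable_cdf μ)
      (abs_cdf_le_one μ) c).aestronglyMeasurable)
    (Eventually.of_forall fun c => ae_of_all _ fun y => ?_)
    integrable_fejerKernel (ae_of_all _ fun y => ?_)
  · rw [Real.norm_eq_abs, abs_mul, abs_of_nonneg (fejerKernel_nonneg y)]
    exact mul_le_of_le_one_right (fejerKernel_nonneg y) (abs_cdf_le_one μ _)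
  · simpa [sub_eq_add_neg] using ((tendsto_cdf_atBot μ).comp
      (tendsto_atBot_add_const_right atBot (-y) tendsto_id)).const_mul (fejerKernel y)

theorem fejerMean_sub_cdf (c : ℝ) :
    fejerMean (fun x => cdf μ x - cdf ν x) c = fejerMean (cdf μ) c - fejerMean (cdf ν) c := by
  simp only [fejerMean, mul_sub]
  exact integral_sub
    (integrable_fejerKernel_mul_comp_sub (measurable_cdf μ) (abs_cdf_le_one μ) c)
    (integrable_fejerKernel_mul_comp_sub (measurable_cdf ν) (abs_cdf_le_one ν) c)

theorem integrable_indicator_Iic_sub_fejerKernel [IsFiniteMeasure μ] (c : ℝ) :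
    Integrable (fun p : ℝ × ℝ => (Iic (c - p.2)).indicator fejerKernel p.1) (volume.prod μ) :=
  (integrable_fejerKernel.comp_fst μ).indicator
    (measurableSet_le measurable_fst (measurable_const.sub measurable_snd))

theorem continuous_integral_fejerKernel_sub [IsFiniteMeasure μ] :
    Continuous fun c => ∫ x, fejerKernel (c - x) ∂μ :=
  continuous_of_dominated (bound := fun _ => 1)
    (fun _ => (continuous_fejerKernel.comp (by fun_prop)).aestronglyMeasurable)
    (fun _ => ae_of_all _ fun _ => abs_fejerKernel_le_one _) (integrable_const _)
    (ae_of_all _ fun _ => continuous_fejerKernel.comp (by fun_prop))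

theorem integral_fejerKernel_sub [IsFiniteMeasure μ] (c : ℝ) :
    ((∫ x, fejerKernel (c - x) ∂μ : ℝ) : ℂ)
      = ∫ t in (-1 : ℝ)..1, ((1 - |t| : ℝ) : ℂ) * Complex.exp (-(t * c) * Complex.I)
          * charFun μ t := by
  have hprod : Integrable (Function.uncurry fun t x : ℝ =>
      ((1 - |t| : ℝ) : ℂ) * Complex.exp (t * (x - c : ℝ) * Complex.I))
      ((volume.restrict (uIoc (-1 : ℝ) 1)).prod μ) := by
    have : IsFiniteMeasure (volume.restrict (uIoc (-1 : ℝ) 1)) := ⟨by simp [uIoc]⟩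
    have hmem := Measure.quasiMeasurePreserving_fst (μ := volume.restrict (uIoc (-1 : ℝ) 1))
      (ν := μ) |>.ae (ae_restrict_mem measurableSet_uIoc)
    refine Integrable.of_bound ?_ 1 ?_
    · apply Continuous.aestronglyMeasurable
      unfold Function.uncurry
      fun_prop
    · filter_upwards [hmem] with p hp
      rw [uIoc_of_le (by norm_num)] at hp
      have hp1 : |p.1| ≤ 1 := abs_le.mpr ⟨hp.1.le, hp.2⟩
      rw [Function.uncurry, norm_mul, Complex.norm_real, ← Complex.ofReal_mul,
        Complex.norm_exp_ofReal_mul_I, mul_one, Real.norm_eq_abs, abs_of_nonneg (by linarith)]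
      linarith [abs_nonneg p.1]
  rw [← integral_complex_ofReal]
  simp_rw [← neg_sub _ c, fejerKernel_neg, ← integral_triangle_mul_exp]
  rw [← intervalIntegral_integral_swap hprod]
  refine intervalIntegral.integral_congr fun t _ => ?_
  rw [charFun_apply_real, ← integral_const_mul]
  refine integral_congr_ae (ae_of_all _ fun x => ?_)
  dsimp only
  rw [mul_assoc _ (Complex.exp _), ← Complex.exp_add]
  push_cast
  ring_nf

variable [IsProbabilityMeasure μ] [IsProbabilityMeasure ν]

theorem fejerMean_cdf (c : ℝ) :
    fejerMean (cdf μ) c = ∫ x, (∫ y in Iic (c - x), fejerKernel y) ∂μ := by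
  have hcdf (y : ℝ) : fejerKernel y * cdf μ (c - y)
      = ∫ x, (Iic (c - x)).indicator fejerKernel y ∂μ := by
    rw [cdf_eq_real, ← integral_indicator_one measurableSet_Iic, ← integral_const_mul]
    refine integral_congr_ae (ae_of_all _ fun x => ?_)
    simp only [indicator_apply, mem_Iic, le_sub_comm, Pi.one_apply, mul_ite, mul_one, mul_zero]
  simp_rw [fejerMean, hcdf]
  rw [integral_integral_swap (integrable_indicator_Iic_sub_fejerKernel μ c)]
  simp_rw [integral_indicator measurableSet_Iic]

theorem fejerMean_cdf_sub (a b : ℝ) :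
    fejerMean (cdf μ) b - fejerMean (cdf μ) a = ∫ c in a..b, ∫ x, fejerKernel (c - x) ∂μ := by
  have hint (c : ℝ) : Integrable (fun x => ∫ y in Iic (c - x), fejerKernel y) μ := by
    simpa only [integral_indicator measurableSet_Iic] using
      (integrable_indicator_Iic_sub_fejerKernel μ c).integral_prod_right
  have hprod : Integrable (Function.uncurry fun c x : ℝ => fejerKernel (c - x))
      ((volume.restrict (uIoc a b)).prod μ) := by
    have : IsFiniteMeasure (volume.restrict (uIoc a b)) := ⟨by simp [uIoc]⟩
    exact Integrable.of_bound (continuous_fejerKernel.comp (by fun_prop)).aestronglyMeasurable 1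
      (ae_of_all _ fun p => abs_fejerKernel_le_one _)
  rw [fejerMean_cdf, fejerMean_cdf, ← integral_sub (hint b) (hint a),
    intervalIntegral_integral_swap hprod]
  simp_rw [intervalIntegral.integral_Iic_sub_Iic integrable_fejerKernel.integrableOn
    integrable_fejerKernel.integrableOn, intervalIntegral.integral_comp_sub_right]

theorem fejerMean_cdf_sub_sub (a b : ℝ) :
    ((fejerMean (fun x => cdf μ x - cdf ν x) b - fejerMean (fun x => cdf μ x - cdf ν x) a : ℝ) : ℂ)
      = ∫ t in (-1 : ℝ)..1, ∫ c in a..b,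
          ((1 - |t| : ℝ) : ℂ) * Complex.exp (-(t * c) * Complex.I)
            * (charFun μ t - charFun ν t) := by
  have hcont : Continuous (Function.uncurry fun c t : ℝ =>
      ((1 - |t| : ℝ) : ℂ) * Complex.exp (-(t * c) * Complex.I)
        * (charFun μ t - charFun ν t)) := by
    unfold Function.uncurry
    fun_prop
  rw [← intervalIntegral_intervalIntegral_swap ((hcont.continuousOn.integrableOn_compact
      ((isCompact_uIcc (a := a) (b := b)).prod (isCompact_uIcc (a := (-1 : ℝ)) (b := 1)))).mono_set
      (prod_mono uIoc_subset_uIcc uIoc_subset_uIcc)),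
    fejerMean_sub_cdf, fejerMean_sub_cdf, sub_sub_sub_comm, fejerMean_cdf_sub, fejerMean_cdf_sub,
    ← intervalIntegral.integral_sub
      ((continuous_integral_fejerKernel_sub μ).intervalIntegrable _ _)
      ((continuous_integral_fejerKernel_sub ν).intervalIntegrable _ _),
    ← intervalIntegral.integral_ofReal]
  refine intervalIntegral.integral_congr fun c _ => ?_
  simp only [mul_sub]
  rw [Complex.ofReal_sub, integral_fejerKernel_sub, integral_fejerKernel_sub,
    ← intervalIntegral.integral_sub (Continuous.intervalIntegrable (by fun_prop) _ _)
      (Continuous.intervalIntegrable (by fun_prop) _ _)]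

theorem abs_fejerMean_sub_cdf_le
    (hint : IntervalIntegrable (fun t => ‖charFun μ t - charFun ν t‖ / |t|) volume (-1) 1) (b : ℝ) :
    |fejerMean (fun x => cdf μ x - cdf ν x) b|
      ≤ 2 * ∫ t in (-1 : ℝ)..1, ‖charFun μ t - charFun ν t‖ / |t| := by
  have hdiff (a : ℝ) :
      |fejerMean (fun x => cdf μ x - cdf ν x) b - fejerMean (fun x => cdf μ x - cdf ν x) a|
        ≤ 2 * ∫ t in (-1 : ℝ)..1, ‖charFun μ t - charFun ν t‖ / |t| := by
    rw [← Real.norm_eq_abs, ← Complex.norm_real, fejerMean_cdf_sub_sub,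
      ← intervalIntegral.integral_const_mul]
    refine intervalIntegral.norm_integral_le_of_norm_le (by norm_num)
      (ae_of_all _ fun t ht => norm_integral_triangle_mul_exp_mul_le
        (abs_le.mpr ⟨ht.1.le, ht.2⟩) ?_ a b) (hint.const_mul 2)
    rintro rfl
    simp
  have hlim : Tendsto (fejerMean fun x => cdf μ x - cdf ν x) atBot (𝓝 0) := by
    simpa [funext (fejerMean_sub_cdf μ ν)] using
      (tendsto_fejerMean_cdf_atBot μ).sub (tendsto_fejerMean_cdf_atBot ν)
  exact le_of_tendsto (by simpa using (hlim.const_sub (fejerMean _ b)).abs)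
    (Eventually.of_forall hdiff)

theorem esseen_smoothing_one
    (hint : IntervalIntegrable (fun t => ‖charFun μ t - charFun ν t‖ / |t|) volume (-1) 1)
    {ε : ℝ} (hε : 0 ≤ ε) (hν : ∀ x y, x ≤ y → cdf ν y - cdf ν x ≤ ε * (y - x)) (x : ℝ) :
    |cdf μ x - cdf ν x|
      ≤ 128 * ε + 4 * ∫ t in (-1 : ℝ)..1, ‖charFun μ t - charFun ν t‖ / |t| := by
  have hbdd : BddAbove (range fun x => |cdf μ x - cdf ν x|) := by
    refine ⟨1, forall_mem_range.mpr fun y => abs_le.mpr ⟨?_, ?_⟩⟩ <;>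
      linarith [cdf_nonneg μ y, cdf_le_one μ y, cdf_nonneg ν y, cdf_le_one ν y]
  have hdec (x y : ℝ) (hxy : x ≤ y) :
      cdf μ x - cdf ν x ≤ cdf μ y - cdf ν y + ε * (y - x) := by
    linarith [monotone_cdf μ hxy, hν x y hxy]
  exact (abs_le_of_abs_fejerMean_le ((measurable_cdf μ).sub (measurable_cdf ν)) hbdd hε hdec
    (abs_fejerMean_sub_cdf_le μ ν hint) x).trans_eq (by ring)

theorem cdf_map_const_mul {T : ℝ} (hT : 0 < T) (x : ℝ) :
    cdf (μ.map (T * ·)) x = cdf μ (x / T) := by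
  have := Measure.isProbabilityMeasure_map (μ := μ) (f := (T * ·)) (by fun_prop)
  rw [cdf_eq_real, cdf_eq_real, map_measureReal_apply (by fun_prop) measurableSet_Iic]
  congr 1
  ext y
  simp [le_div_iff₀' hT]

theorem esseen_smoothing {T : ℝ} (hT : 0 < T)
    (hint : IntervalIntegrable (fun t => ‖charFun μ t - charFun ν t‖ / |t|) volume (-T) T)
    {ε : ℝ} (hε : 0 ≤ ε) (hν : ∀ x y, x ≤ y → cdf ν y - cdf ν x ≤ ε * (y - x)) (x : ℝ) :
    |cdf μ x - cdf ν x|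
      ≤ 128 * ε / T + 4 * ∫ t in (-T)..T, ‖charFun μ t - charFun ν t‖ / |t| := by
  have := Measure.isProbabilityMeasure_map (μ := μ) (f := (T * ·)) (by fun_prop)
  have := Measure.isProbabilityMeasure_map (μ := ν) (f := (T * ·)) (by fun_prop)
  have hφ : (fun t => ‖charFun (μ.map (T * ·)) t - charFun (ν.map (T * ·)) t‖ / |t|)
      = fun t => T * (‖charFun μ (T * t) - charFun ν (T * t)‖ / |T * t|) := by
    ext t
    rw [charFun_map_mul, charFun_map_mul, abs_mul, abs_of_pos hT]
    rcases eq_or_ne t 0 with rfl | ht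
    · simp
    · field_simp
  have hunit := esseen_smoothing_one (μ.map (T * ·)) (ν.map (T * ·)) (ε := ε / T) ?_
    (by positivity) ?_ (T * x)
  · rw [hφ, intervalIntegral.integral_const_mul,
      intervalIntegral.mul_integral_comp_mul_left (f := fun t => ‖charFun μ t - charFun ν t‖ / |t|),
      cdf_map_const_mul μ hT, cdf_map_const_mul ν hT, mul_div_cancel_left₀ x hT.ne', mul_one,
      mul_neg_one, ← mul_div_assoc] at hunit
    exact hunit
  · rw [hφ]
    simpa [hT.ne', neg_div] using (hint.comp_mul_left (c := T)).const_mul T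
  · intro y z hyz
    rw [cdf_map_const_mul ν hT, cdf_map_const_mul ν hT]
    exact (hν _ _ (by gcongr)).trans_eq (by ring)

end CharFun

/-! ### Comparison with the Gaussian distribution -/

theorem gaussianPDFReal_le (m : ℝ) (v : NNReal) (z : ℝ) :
    gaussianPDFReal m v z ≤ (√v)⁻¹ := by
  rcases eq_or_ne v 0 with rfl | hv
  · simp
  · have hv0 : (0 : ℝ) < v := NNReal.coe_pos.mpr (pos_iff_ne_zero.mpr hv)
    calc (√(2 * π * v))⁻¹ * Real.exp (-(z - m) ^ 2 / (2 * v)) ≤ (√v)⁻¹ * 1 := by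
          gcongr
          · nlinarith [Real.pi_gt_three]
          · exact Real.exp_le_one_iff.mpr
              (div_nonpos_of_nonpos_of_nonneg (neg_nonpos.mpr (sq_nonneg _)) (by positivity))
      _ = (√v)⁻¹ := mul_one _

theorem cdf_gaussianReal_sub_le (m : ℝ) {v : NNReal} (hv : v ≠ 0) {x y : ℝ} (hxy : x ≤ y) :
    cdf (gaussianReal m v) y - cdf (gaussianReal m v) x ≤ (√v)⁻¹ * (y - x) := by
  have hIoc : (gaussianReal m v).real (Iic y) - (gaussianReal m v).real (Iic x)
      = (gaussianReal m v).real (Ioc x y) := by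
    rw [← Iic_union_Ioc_eq_Iic hxy, measureReal_union (Iic_disjoint_Ioc le_rfl) measurableSet_Ioc,
      add_sub_cancel_left]
  rw [cdf_eq_real, cdf_eq_real, hIoc, measureReal_def, gaussianReal_apply_eq_integral m hv,
    ENNReal.toReal_ofReal (integral_nonneg fun _ => gaussianPDFReal_nonneg _ _ _)]
  calc ∫ z in Ioc x y, gaussianPDFReal m v z ≤ ∫ _ in Ioc x y, (√v)⁻¹ :=
        setIntegral_mono (integrable_gaussianPDFReal m v).integrableOn
          (integrableOn_const (by simp)) (gaussianPDFReal_le m v)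
    _ = (√v)⁻¹ * (y - x) := by
        rw [setIntegral_const, Real.volume_real_Ioc_of_le hxy, smul_eq_mul, mul_comm]

theorem norm_exp_add_sub_exp_le {s y : ℝ} {R : ℂ} (hs : 0 ≤ s) (hs4 : s ≤ 1 / 4) (hy : 0 ≤ y)
    (hR : ‖R‖ ≤ s * y) :
    ‖Complex.exp (-(y / 2) + R) - Complex.exp (-(y / 2))‖ ≤ 8 * s * Real.exp (-(y / 8)) := by
  have hexp : ‖Complex.exp R - 1‖ ≤ s * y * Real.exp (y / 4) := by
    have hR1 := Complex.norm_exp_sub_sum_le_norm_mul_exp R 1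
    rw [Finset.sum_range_one, pow_zero, Nat.factorial_zero, Nat.cast_one, div_one, pow_one] at hR1
    refine hR1.trans ?_
    gcongr
    nlinarith
  have hsy : s * y ≤ 8 * s * Real.exp (y / 8) := by
    nlinarith [Real.add_one_le_exp (y / 8)]
  have hnorm : ‖Complex.exp (-(y / 2))‖ = Real.exp (-(y / 2)) := by
    rw [Complex.norm_exp]
    norm_cast
  calc ‖Complex.exp (-(y / 2) + R) - Complex.exp (-(y / 2))‖
      = Real.exp (-(y / 2)) * ‖Complex.exp R - 1‖ := by
        rw [Complex.exp_add, ← mul_sub_one, norm_mul, hnorm]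
    _ ≤ Real.exp (-(y / 2)) * (8 * s * Real.exp (y / 8) * Real.exp (y / 4)) := by
        gcongr
        exact hexp.trans (by gcongr)
    _ = 8 * s * Real.exp (-(y / 2) + y / 8 + y / 4) := by
        rw [Real.exp_add, Real.exp_add]
        ring
    _ = 8 * s * Real.exp (-(y / 8)) := by ring_nf

section CharFunExpansion

variable {μ : Measure ℝ} {T : ℝ} (hT : 0 < T)
  (hμ : ∀ t : ℝ, |t| ≤ T → ∃ R : ℂ,
    charFun μ t = Complex.exp (-(t ^ 2 / 2) + R) ∧ ‖R‖ ≤ |t| ^ 3 / (4 * T))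

include hT hμ

theorem norm_charFun_sub_gaussianReal_div_le {t : ℝ} (ht : |t| ≤ T) :
    ‖charFun μ t - charFun (gaussianReal 0 1) t‖ / |t| ≤ 2 / T * Real.exp (-(1 / 8) * t ^ 2) := by
  obtain ⟨R, hR, hRle⟩ := hμ t ht
  have hgauss : charFun (gaussianReal 0 1) t = Complex.exp (-((t ^ 2 : ℝ) / 2)) := by
    rw [charFun_gaussianReal]
    push_cast
    ring_nf
  rw [hR, hgauss, ← Complex.ofReal_pow]
  refine div_le_of_le_mul₀ (abs_nonneg t) (by positivity)
    ((norm_exp_add_sub_exp_le (s := |t| / (4 * T)) (by positivity) ?_ (sq_nonneg t) ?_).trans_eq ?_)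
  · rw [div_le_div_iff₀ (by positivity) (by norm_num)]
    linarith
  · exact hRle.trans_eq (by rw [← sq_abs t]; ring)
  · ring_nf

theorem intervalIntegrable_norm_charFun_sub_gaussianReal_div [IsFiniteMeasure μ] :
    IntervalIntegrable (fun t => ‖charFun μ t - charFun (gaussianReal 0 1) t‖ / |t|)
      volume (-T) T := by
  have hbound : Continuous fun t : ℝ => 2 / T * Real.exp (-(1 / 8) * t ^ 2) := by fun_prop
  refine (hbound.intervalIntegrable (-T) T).mono_fun'
    (Measurable.aestronglyMeasurable (by fun_prop))
    ((ae_restrict_mem measurableSet_uIoc).mono fun t ht => ?_)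
  rw [uIoc_of_le (by linarith)] at ht
  refine (Real.norm_of_nonneg (by positivity)).trans_le ?_
  exact norm_charFun_sub_gaussianReal_div_le hT hμ (abs_le.mpr ⟨ht.1.le, ht.2⟩)

theorem integral_norm_charFun_sub_gaussianReal_div_le [IsFiniteMeasure μ] :
    ∫ t in (-T)..T, ‖charFun μ t - charFun (gaussianReal 0 1) t‖ / |t| ≤ 12 / T := by
  have hTT : -T ≤ T := by linarith
  have hbound : Integrable fun t : ℝ => Real.exp (-(1 / 8) * t ^ 2) :=
    integrable_exp_neg_mul_sq (by norm_num)
  have hsqrt : √(π / (1 / 8)) ≤ 6 :=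
    Real.sqrt_le_iff.mpr ⟨by norm_num, by linarith [Real.pi_lt_four]⟩
  calc ∫ t in (-T)..T, ‖charFun μ t - charFun (gaussianReal 0 1) t‖ / |t|
      ≤ ∫ t in (-T)..T, 2 / T * Real.exp (-(1 / 8) * t ^ 2) :=
        intervalIntegral.integral_mono_on hTT
          (intervalIntegrable_norm_charFun_sub_gaussianReal_div hT hμ)
          (hbound.const_mul _).intervalIntegrable
          fun t ht => norm_charFun_sub_gaussianReal_div_le hT hμ (abs_le.mpr ht)
    _ ≤ 2 / T * ∫ t, Real.exp (-(1 / 8) * t ^ 2) := by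
        rw [intervalIntegral.integral_const_mul, intervalIntegral.integral_of_le hTT]
        refine mul_le_mul_of_nonneg_left ?_ (by positivity)
        exact setIntegral_le_integral hbound (ae_of_all _ fun t => (Real.exp_pos _).le)
    _ ≤ 2 / T * 6 := by
        rw [integral_gaussian]
        gcongr
    _ = 12 / T := by ring

theorem abs_cdf_sub_cdf_gaussianReal_le [IsProbabilityMeasure μ] (x : ℝ) :
    |cdf μ x - cdf (gaussianReal 0 1) x| ≤ 176 / T := by
  have hlip (y z : ℝ) (hyz : y ≤ z) :
      cdf (gaussianReal 0 1) z - cdf (gaussianReal 0 1) y ≤ 1 * (z - y) := by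
    simpa using cdf_gaussianReal_sub_le 0 one_ne_zero hyz
  calc |cdf μ x - cdf (gaussianReal 0 1) x|
      ≤ 128 * 1 / T + 4 * ∫ t in (-T)..T, ‖charFun μ t - charFun (gaussianReal 0 1) t‖ / |t| :=
        esseen_smoothing μ _ hT (intervalIntegrable_norm_charFun_sub_gaussianReal_div hT hμ)
          zero_le_one hlip x
    _ ≤ 128 * 1 / T + 4 * (12 / T) := by
        gcongr
        exact integral_norm_charFun_sub_gaussianReal_div_le hT hμ
    _ = 176 / T := by ring

end CharFunExpansion

/-! ### Moment generating functions -/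

section MomentGeneratingFunction

variable {Ω : Type*} [MeasurableSpace Ω] {P : Measure Ω} {X : Ω → ℝ}

theorem integrableExpSet_eq_univ (hX : ∀ ρ : ℝ, 0 < ρ → Integrable (fun ω => ρ ^ X ω) P) :
    integrableExpSet X P = univ :=
  eq_univ_of_forall fun t => by
    simpa only [← Real.exp_mul] using! hX (Real.exp t) (Real.exp_pos t)

theorem complexMGF_conj (w : ℂ) : complexMGF X P (conj w) = conj (complexMGF X P w) := by
  rw [complexMGF, complexMGF, ← integral_conj]
  simp only [← Complex.exp_conj, map_mul, Complex.conj_ofReal]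

theorem norm_complexMGF_le_norm_re (w : ℂ) : ‖complexMGF X P w‖ ≤ ‖complexMGF X P w.re‖ := by
  rw [complexMGF_ofReal, Complex.norm_real, Real.norm_of_nonneg mgf_nonneg]
  exact norm_complexMGF_le_mgf

theorem complexMGF_zero [IsProbabilityMeasure P] : complexMGF X P 0 = 1 := by
  simp [complexMGF]

theorem logDeriv_complexMGF_zero [IsProbabilityMeasure P]
    (hX : 0 ∈ interior (integrableExpSet X P)) :
    logDeriv (complexMGF X P) 0 = ((∫ ω, X ω ∂P : ℝ) : ℂ) := by
  rw [logDeriv_apply, (hasDerivAt_complexMGF hX).deriv, complexMGF_zero, div_one,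
    ← integral_complex_ofReal]
  simp

theorem deriv_logDeriv_complexMGF_zero [IsProbabilityMeasure P]
    (hX : 0 ∈ interior (integrableExpSet X P)) :
    deriv (logDeriv (complexMGF X P)) 0 = ((variance X P : ℝ) : ℂ) := by
  have hfirst : HasDerivAt (complexMGF X P) ((∫ ω, X ω ∂P : ℝ) : ℂ) 0 := by
    convert hasDerivAt_complexMGF (X := X) (μ := P) (z := 0) hX using 1
    simp [integral_complex_ofReal]
  have hsecond : HasDerivAt (deriv (complexMGF X P)) ((∫ ω, X ω ^ 2 ∂P : ℝ) : ℂ) 0 := by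
    convert! hasDerivAt_iteratedDeriv_complexMGF (X := X) (μ := P) (z := 0) hX 1 using 1
    · rw [iteratedDeriv_one]
    · simp [← integral_complex_ofReal]
  have hquot := hsecond.div hfirst (by simp [complexMGF_zero])
  have hL2 : MemLp X 2 P := by
    simpa using memLp_of_mem_interior_integrableExpSet hX 2
  rw [show logDeriv (complexMGF X P) = deriv (complexMGF X P) / complexMGF X P from rfl,
    hquot.deriv, complexMGF_zero, hfirst.deriv, variance_eq_sub hL2]
  simp [sq]

theorem aemeasurable_standardize (hX : AEMeasurable X P) : AEMeasurable (standardize X P) P :=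
  (hX.sub_const _).div_const _

theorem charFun_map_standardize (hX : AEMeasurable X P) (t : ℝ) :
    charFun (P.map (standardize X P)) t
      = Complex.exp (-((∫ ω, X ω ∂P : ℝ) * ((t / stdDev X P : ℝ) * Complex.I)))
        * complexMGF X P ((t / stdDev X P : ℝ) * Complex.I) := by
  rw [← complexMGF_mul_I (aemeasurable_standardize hX), complexMGF, complexMGF,
    ← integral_const_mul]
  refine integral_congr_ae (ae_of_all _ fun ω => ?_)
  simp only [standardize, ← Complex.exp_add]
  push_cast
  ring_nf

theorem probGenFun_exp {w : ℂ} (hw : w ∈ strip π) :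
    probGenFun X P (Complex.exp w) = complexMGF X P w := by
  obtain ⟨hlo, hhi⟩ := abs_lt.mp (mem_strip.mp hw)
  simp_rw [probGenFun, complexMGF, Complex.log_exp hlo hhi.le, mul_comm]

theorem exp_mem_sector {δ : ℝ} (hδ : δ ≤ π) {w : ℂ} (hw : w ∈ strip δ) :
    Complex.exp w ∈ sector δ := by
  obtain ⟨hlo, hhi⟩ := abs_lt.mp (mem_strip.mp hw)
  have harg : Complex.arg (Complex.exp w) = w.im := by
    rw [← Complex.log_im, Complex.log_exp (by linarith) (by linarith)]
  exact ⟨Complex.exp_ne_zero w, harg.symm ▸ hw⟩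

theorem complexMGF_ne_zero {δ : ℝ} (hδ : δ ≤ π)
    (hX : ∀ z ∈ sector δ, probGenFun X P z ≠ 0) {w : ℂ} (hw : w ∈ strip δ) :
    complexMGF X P w ≠ 0 := by
  rw [← probGenFun_exp (lt_of_lt_of_le (mem_strip.mp hw) hδ)]
  exact hX _ (exp_mem_sector hδ hw)

theorem tendsto_exp_cobounded_inf_sector {δ : ℝ} (hδ : δ ≤ π) :
    Tendsto Complex.exp (comap Complex.re atTop ⊓ 𝓟 (strip δ))
      (Bornology.cobounded ℂ ⊓ 𝓟 (sector δ)) := by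
  refine Tendsto.inf ?_ (tendsto_principal_principal.mpr fun w hw => exp_mem_sector hδ hw)
  rw [← tendsto_norm_atTop_iff_cobounded]
  simpa only [Complex.norm_exp, Function.comp_def] using Real.tendsto_exp_atTop.comp tendsto_comap

theorem isBigO_of_tendsto_sector {δ κ : ℝ} {v : ℂ → ℝ} (hδ : δ ≤ π)
    (hv : Tendsto (fun z => |v z| / ‖z‖ ^ κ) (Bornology.cobounded ℂ ⊓ 𝓟 (sector δ)) (𝓝 0)) :
    (fun w => v (Complex.exp w)) =O[comap Complex.re atTop ⊓ 𝓟 (strip δ)]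
      fun w => Real.exp (κ * w.re) := by
  refine Asymptotics.IsBigO.of_bound 1 ?_
  filter_upwards [(hv.comp (tendsto_exp_cobounded_inf_sector hδ)).eventually_lt_const one_pos]
    with w hw
  rw [Function.comp_apply, Complex.norm_exp, ← Real.exp_mul, div_lt_one (Real.exp_pos _),
    mul_comm] at hw
  simpa using hw.le

theorem GrowthCondition.isBigO_log_norm_complexMGF {δ κ : ℝ} (hδ : δ ≤ π)
    (hX : GrowthCondition κ δ (logPotential X P)) :
    (fun w => Real.log ‖complexMGF X P w‖)
      =O[comap (abs ∘ Complex.re) atTop ⊓ 𝓟 (strip δ)] fun w => Real.exp (κ * |w.re|) := by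
  have hlog {w : ℂ} (hw : w ∈ strip δ) :
      logPotential X P (Complex.exp w) = Real.log ‖complexMGF X P w‖ := by
    rw [logPotential, probGenFun_exp (lt_of_lt_of_le (mem_strip.mp hw) hδ)]
  have hneg : Tendsto (fun w : ℂ => -w) (comap Complex.re atBot ⊓ 𝓟 (strip δ))
      (comap Complex.re atTop ⊓ 𝓟 (strip δ)) := by
    refine Tendsto.inf (tendsto_comap_iff.mpr (tendsto_neg_atBot_atTop.comp tendsto_comap))
      (tendsto_principal_principal.mpr fun w hw => ?_)
    simpa [mem_strip] using hw
  rw [← comap_comap, comap_abs_atTop, comap_sup, inf_sup_right]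
  refine Asymptotics.IsBigO.sup ?_ ?_
  · refine ((isBigO_of_tendsto_sector (v := fun z => logPotential X P (1 / z)) hδ
      hX.2).comp_tendsto hneg).congr' ?_ ?_
    · filter_upwards [mem_inf_of_right (mem_principal_self (strip δ))] with w hw
      simp [Complex.exp_neg, hlog hw]
    · filter_upwards [mem_inf_of_left (preimage_mem_comap (Iic_mem_atBot 0))] with w hw
      simp [abs_of_nonpos (mem_Iic.mp (mem_preimage.mp hw))]
  · refine (isBigO_of_tendsto_sector hδ hX.1).congr' ?_ ?_
    · filter_upwards [mem_inf_of_right (mem_principal_self (strip δ))] with w hw using hlog hw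
    · filter_upwards [mem_inf_of_left (preimage_mem_comap (Ici_mem_atTop 0))] with w hw
      rw [abs_of_nonneg (mem_Ici.mp (mem_preimage.mp hw))]

theorem zeroFreeRidge_complexMGF {δ κ : ℝ} (hX : integrableExpSet X P = univ)
    (hzero : ∀ w ∈ strip δ, complexMGF X P w ≠ 0)
    (hgrowth : (fun w => Real.log ‖complexMGF X P w‖)
      =O[comap (abs ∘ Complex.re) atTop ⊓ 𝓟 (strip δ)] fun w => Real.exp (κ * |w.re|)) :
    ZeroFreeRidge (complexMGF X P) δ κ where
  differentiableOn w _ :=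
    (hasDerivAt_complexMGF (by simp [hX])).differentiableAt.differentiableWithinAt
  map_conj w _ := complexMGF_conj w
  norm_le_norm_re w _ := norm_complexMGF_le_norm_re w
  ne_zero := hzero
  log_norm_isBigO := hgrowth

variable [IsProbabilityMeasure P]

theorem exists_complexMGF_eq_exp {δ κ h : ℝ} (hX : integrableExpSet X P = univ)
    (hM : ZeroFreeRidge (complexMGF X P) δ κ) (hh : 0 < h) (hδ : 2 * h ≤ δ) (hκ : κ * h ≤ π)
    {w : ℂ} (hw : ‖w‖ ≤ h / 2) :
    ∃ R : ℂ, complexMGF X P w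
        = Complex.exp ((∫ ω, X ω ∂P : ℝ) * w + (variance X P : ℝ) * w ^ 2 / 2 + R) ∧
      ‖R‖ ≤ 6 * variance X P / h * ‖w‖ ^ 3 := by
  have h0 : 0 ∈ interior (integrableExpSet X P) := by simp [hX]
  simpa [complexMGF_zero, logDeriv_complexMGF_zero h0, deriv_logDeriv_complexMGF_zero h0,
    abs_of_nonneg (variance_nonneg X P)] using hM.exists_eq_exp hh hδ hκ hw

theorem exists_charFun_standardize_eq_exp {δ κ h : ℝ} (hX : integrableExpSet X P = univ)
    (hM : ZeroFreeRidge (complexMGF X P) δ κ) (hh : 0 < h) (hδ : 2 * h ≤ δ) (hκ : κ * h ≤ π)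
    (hσ : 0 < stdDev X P) {t : ℝ} (ht : |t| ≤ stdDev X P * h / 2) :
    ∃ R : ℂ, charFun (P.map (standardize X P)) t = Complex.exp (-(t ^ 2 / 2) + R) ∧
      ‖R‖ ≤ 6 * |t| ^ 3 / (stdDev X P * h) := by
  have hmeas : AEMeasurable X P := aemeasurable_of_mem_interior_integrableExpSet (v := 0)
    (by simp [hX])
  have hvar : variance X P = stdDev X P ^ 2 := (Real.sq_sqrt (variance_nonneg X P)).symm
  have hnorm : ‖((t / stdDev X P : ℝ) : ℂ) * Complex.I‖ = |t| / stdDev X P := by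
    rw [norm_mul, Complex.norm_I, mul_one, Complex.norm_real, Real.norm_eq_abs, abs_div,
      abs_of_pos hσ]
  obtain ⟨R, hR, hRle⟩ := exists_complexMGF_eq_exp hX hM hh hδ hκ
    (w := ((t / stdDev X P : ℝ) : ℂ) * Complex.I) (by rw [hnorm, div_le_iff₀ hσ]; linarith)
  refine ⟨R, ?_, hRle.trans_eq ?_⟩
  · have hσ0 : (stdDev X P : ℂ) ≠ 0 := mod_cast hσ.ne'
    rw [charFun_map_standardize hmeas, hR, hvar, ← Complex.exp_add, mul_pow, Complex.I_sq]
    congr 1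
    push_cast
    field_simp
    ring
  · rw [hnorm, hvar]
    field_simp

theorem cdf_map_standardize (hX : AEMeasurable X P) (t : ℝ) :
    cdf (P.map (standardize X P)) t = P.real {ω | standardize X P ω ≤ t} := by
  have hstd := aemeasurable_standardize hX
  have := Measure.isProbabilityMeasure_map hstd
  rw [cdf_eq_real, map_measureReal_apply_of_aemeasurable hstd measurableSet_Iic]
  rfl

theorem abs_measureReal_standardize_le_sub_gaussianReal_le {δ κ h : ℝ}
    (hX : integrableExpSet X P = univ) (hM : ZeroFreeRidge (complexMGF X P) δ κ) (hh : 0 < h)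
    (hδ : 2 * h ≤ δ) (hκ : κ * h ≤ π) (hσ : 0 < stdDev X P) (t : ℝ) :
    |P.real {ω | standardize X P ω ≤ t} - (gaussianReal 0 1).real (Iic t)|
      ≤ 4224 / (stdDev X P * h) := by
  have hmeas : AEMeasurable X P := aemeasurable_of_mem_interior_integrableExpSet (v := 0)
    (by simp [hX])
  have := Measure.isProbabilityMeasure_map (aemeasurable_standardize hmeas)
  have hexpand (s : ℝ) (hs : |s| ≤ stdDev X P * h / 24) : ∃ R : ℂ,
      charFun (P.map (standardize X P)) s = Complex.exp (-(s ^ 2 / 2) + R) ∧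
      ‖R‖ ≤ |s| ^ 3 / (4 * (stdDev X P * h / 24)) := by
    obtain ⟨R, hR, hRle⟩ := exists_charFun_standardize_eq_exp hX hM hh hδ hκ hσ
      (hs.trans (div_le_div_of_nonneg_left (by positivity) two_pos (by norm_num)))
    exact ⟨R, hR, hRle.trans_eq (by field_simp; ring)⟩
  rw [← cdf_map_standardize hmeas, ← cdf_eq_real]
  exact (abs_cdf_sub_cdf_gaussianReal_le (by positivity) hexpand t).trans_eq (by field_simp; ring)

end MomentGeneratingFunction

theorem mainTheorem4_general {Ω : Type*} [MeasurableSpace Ω] (P : Measure Ω)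
    [IsProbabilityMeasure P] (X : Ω → ℝ) (δ κ : ℝ) (hδ : 0 < δ)
    (hfin : integrableExpSet X P = univ) (hzero : ∀ w ∈ strip δ, complexMGF X P w ≠ 0)
    (hgrowth : (fun w => Real.log ‖complexMGF X P w‖)
      =O[comap (abs ∘ Complex.re) atTop ⊓ 𝓟 (strip δ)] fun w => Real.exp (κ * |w.re|))
    (hσ : 0 < stdDev X P) :
    (⨆ t : ℝ, |P.real {ω | standardize X P ω ≤ t} - (gaussianReal 0 1).real (Iic t)|)
      ≤ 2 ^ 14 * (max δ⁻¹ κ / stdDev X P) := by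
  have hM := zeroFreeRidge_complexMGF hfin hzero hgrowth
  set K := max δ⁻¹ κ
  have hK : 0 < K := (inv_pos.mpr hδ).trans_le (le_max_left _ _)
  have hδK : 2 * (1 / (2 * K)) ≤ δ := by
    field_simp
    exact (inv_le_iff_one_le_mul₀ hδ).mp (le_max_left _ _)
  have hκK : κ * (1 / (2 * K)) ≤ π := by
    rw [mul_one_div, div_le_iff₀ (by positivity)]
    nlinarith [Real.pi_gt_three, le_max_right δ⁻¹ κ]
  refine ciSup_le fun t => ?_
  calc |P.real {ω | standardize X P ω ≤ t} - (gaussianReal 0 1).real (Iic t)|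
      ≤ 4224 / (stdDev X P * (1 / (2 * K))) :=
        abs_measureReal_standardize_le_sub_gaussianReal_le hfin hM (by positivity) hδK hκK hσ t
    _ = 8448 * (K / stdDev X P) := by field_simp; norm_num
    _ ≤ 2 ^ 14 * (K / stdDev X P) := by gcongr; norm_num

theorem mainTheorem4 {Ω : Type*} [MeasurableSpace Ω] (P : Measure Ω) [IsProbabilityMeasure P]
    (X : Ω → ℝ) (hX : AEMeasurable X P)
    (δ κ : ℝ) (hδ : 0 < δ) (hδπ : δ ≤ Real.pi) (hκ : 0 < κ)
    -- the generating function is finite on the positive reals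
    (hfin : ∀ ρ : ℝ, 0 < ρ → Integrable (fun ω => ρ ^ (X ω)) P)
    (hzero : ∀ z ∈ sector δ, probGenFun X P z ≠ 0)
    (hgrowth : GrowthCondition κ δ (logPotential X P))
    (hσ : 0 < stdDev X P) :
    (⨆ t : ℝ, |P.real {ω | standardize X P ω ≤ t} - (gaussianReal 0 1).real (Set.Iic t)|)
      ≤ (2 : ℝ) ^ 3258 * (max δ⁻¹ κ / stdDev X P) := by
  refine (mainTheorem4_general P X δ κ hδ (integrableExpSet_eq_univ hfin)
    (fun w hw => complexMGF_ne_zero hδπ hzero hw) (hgrowth.isBigO_log_norm_complexMGF hδπ)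
    hσ).trans ?_
  gcongr <;> norm_num
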